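/- Let $\tau\in\mathbb{C}$ with $\operatorname{im}\tau>0$, $\Lambda_\tau=\mathbb{Z}+\mathbb{Z}\tau$, $E=\mathbb{C}/\Lambda_\tau$, and identify functions on $E^n$ with their lifts to $\mathbb{C}^n$. Let $\theta(z)=\vartheta_{(\frac12,\frac12)}(z)/\vartheta_{(\frac12,\frac12)}'(0)$ be the odd Jacobi theta function normalized by $\theta'(0)=1$, and put $\mathbf{A}(z)=-\frac{\pi}{\operatorname{im}\tau}(\bar z-z)$. The Eisenstein--Kronecker functions $\widehat e_m$ ($m\ge 0$) are the functions of $z\notin\Lambda_\tau$ defined by the Laurent expansion at $c=0$ $$e^{c\mathbf{A}(z)}\,\frac{\theta(z+c)}{\theta(z)\theta(c)}=\frac1c\sum_{m\ge 0}\widehat e_m(z)\,c^m .$$ For a function $f$ on $E$ that is smooth except for holomorphic poles at finitely many points (i.e. locally of the form $h(z)/(z-p)^N$ with $h$ smooth), let $\mathrm{res}_\partial(f\,dz)=\sum_{p}\lim_{\varepsilon\to0}\frac{1}{2\pi \mathbf{i}}\oint_{|z-p|=\varepsilon}f\,dz$, where $p$ runs over the poles of $f$ on $E$. With $\mathrm{vol}=\frac{\mathbf{i}}{2\operatorname{im}\tau}dz\wedge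 d\bar z$, let ${-}\!\!\!\!\!\!\int_E f\,\mathrm{vol}=\frac{\mathbf{i}}{2\operatorname{im}\tau}\int_E a\,dz\wedge d\bar z$ be the regularized integral, where $f\,dz\wedge d\bar z=a\,dz\wedge d\bar z+\partial(b\,d\bar z)$, $a$ is smooth except for at most simple holomorphic poles and $b$ is smooth except for holomorphic poles. For a function $f$ of $z_1,\dots,z_n$ the iterated operations are taken with $z_1$ first: $$\mathrm{res}_\partial(f)=\mathrm{res}_\partial\,dz_n\cdots\mathrm{res}_\partial\,dz_2\,\mathrm{res}_\partial(f\,dz_1),\qquad {-}\!\!\!\!\!\!\int_{E_{[n]}}f={-}\!\!\!\!\!\!\int_{E_n}\mathrm{vol}_n\cdots{-}\!\!\!\!\!\!\int_{E_2}\mathrm{vol}_2\,{-}\!\!\!\!\!\!\int_{E_1}f\,\mathrm{vol}_1 ,$$ each intermediate result being a function defined off a finite union of divisors of the form $z_k=t$ or $z_k-z_l=t$ in the remaining variables. Let $n\ge 2$, let $z_0\in\mathbb{C}$, $\mathrm{m}=(m_1,\dots,m_n)\in\mathbb{Z}_{\ge0}^n$, $|\mathrm{m}|=\sum_k m_k$,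 and let $c_{k,\ell}\in\mathbb{C}$ be constants with $\sum_{k=1}^n c_{k,k+1}\notin\Lambda_\tau$, where indices are cyclic ($n+1:=1$). Put $s_{k,\ell}=c_{k,\ell}+z_k-z_\ell$ and $$\xi_{\mathrm{chain}}=\prod_{k=1}^{n-1}\widehat e_{m_k}(s_{k,k+1})\cdot\widehat e_{m_n}(z_n-z_0),\qquad \xi_{\mathrm{loop}}=\prod_{k=1}^{n}\widehat e_{m_k}(s_{k,k+1}).$$ Then all the following iterated residues and iterated regularized integrals exist, and (i) $\displaystyle \mathrm{res}_\partial(\xi_{\mathrm{chain}})=\prod_{k=1}^n\delta_{m_k,1}$ and $\displaystyle\mathrm{res}_\partial(\xi_{\mathrm{loop}})=0$; (ii) $\displaystyle {-}\!\!\!\!\!\!\int_{E_{[n]}}\xi_{\mathrm{chain}}=\prod_{k=1}^n\delta_{m_k,0}$ and $${-}\!\!\!\!\!\!\int_{E_{[n]}}\xi_{\mathrm{loop}}=\widehat e_{|\mathrm{m}|}\Big(\sum_{k=1}^n s_{k,k+1}\Big)\cdot\Big(\prod_{k=1}^n\delta_{m_k,0}-\prod_{k=1}^n(\delta_{m_k,0}-1)\Big),$$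 where $\sum_k s_{k,k+1}=\sum_k c_{k,k+1}$ is a constant. -/

import Mathlib

open scoped ContDiff Topology

noncomputable section

namespace EllipticIterated

/-- The period lattice `Λ_τ = ℤ + ℤτ`.  Functions on `E = ℂ / Λ_τ` are identified with their lifts
to `ℂ`, and functions on `E ^ n` with their lifts to `Fin n → ℂ`. -/
def lattice (τ : ℂ) : Set ℂ :=
  {z | ∃ a b : ℤ, z = a + b * τ}

/-- The union of the cosets `p + Λ_τ`, `p ∈ S`: the preimage in `ℂ` of a finite subset of `E`. -/
def poleSet (τ : ℂ) (S : Finset ℂ) : Set ℂ :=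
  {z | ∃ p ∈ S, z - p ∈ lattice τ}

/-- The half-open period parallelogram. -/
def fundDomain (τ : ℂ) : Set ℂ :=
  (fun x : ℝ × ℝ => (x.1 : ℂ) + x.2 * τ) '' (Set.Ico (0 : ℝ) 1 ×ˢ Set.Ico (0 : ℝ) 1)

/-! ### Theta function, Kronecker theta function and the functions `ê_m` -/

/-- The theta function with characteristic `(1/2, 1/2)`, i.e.
`∑ₙ exp (π i (n + 1/2)² τ + 2 π i (n + 1/2) (z + 1/2))`. -/
def thetaChar (τ z : ℂ) : ℂ :=
  Complex.exp (Real.pi * Complex.I * τ / 4 + Real.pi * Complex.I * (z + 1 / 2)) *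
    jacobiTheta₂ (z + 1 / 2 + τ / 2) τ

/-- The odd theta function normalized by `θ'(0) = 1`. -/
def theta (τ z : ℂ) : ℂ :=
  thetaChar τ z / deriv (thetaChar τ) 0

/-- `Y = - π / im τ`. -/
def Yconst (τ : ℂ) : ℂ :=
  -(Real.pi : ℂ) / (τ.im : ℂ)

/-- `A(z) = Y (z̄ - z)`. -/
def Afun (τ z : ℂ) : ℂ :=
  Yconst τ * ((starRingEnd ℂ) z - z)

/-- The elliptic completion `Ŝ_c(z) = exp (c A(z)) θ(z + c) / (θ(z) θ(c))` of the Kronecker theta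
function. -/
def Shat (τ c z : ℂ) : ℂ :=
  Complex.exp (c * Afun τ z) * (theta τ (z + c) / (theta τ z * theta τ c))

/-- The Eisenstein–Kronecker function `ê_m(z)`, defined by the Laurent expansion
`Ŝ_c(z) = (1 / c) ∑_{m ≥ 0} ê_m(z) c ^ m` at `c = 0`, for `z ∉ Λ_τ`.  The function `c ↦ c Ŝ_c(z)`
has a removable singularity at `c = 0`, with limit `1`. -/
def ehat (τ : ℂ) (m : ℕ) (z : ℂ) : ℂ :=
  iteratedDeriv m (Function.update (fun c : ℂ => c * Shat τ c z) 0 1) 0 / (m.factorial : ℂ)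

/-! ### Functions on `E` that are smooth except for holomorphic poles -/

/-- Near `p`, the function `f` is of the form `h(z) / (z - p) ^ N` with `h` smooth
(not necessarily holomorphic). -/
def HasHolPoleAt (f : ℂ → ℂ) (p : ℂ) (N : ℕ) : Prop :=
  ∃ h : ℂ → ℂ, ContDiffAt ℝ ∞ h p ∧ ∀ᶠ z in 𝓝[≠] p, (z - p) ^ N * f z = h z

/-- `f` is an element of `A⁰_E(⋆ S)`: off the image of `S` in `E` it is a smooth function on `E`,
and it has holomorphic poles at the points of `S`.
The values of `f` at points of `S + Λ_τ` are irrelevant. -/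
structure MemPolar (τ : ℂ) (S : Finset ℂ) (f : ℂ → ℂ) : Prop where
  periodic : ∀ z ∉ poleSet τ S, ∀ l ∈ lattice τ, f (z + l) = f z
  smooth : ContDiffOn ℝ ∞ f (poleSet τ S)ᶜ
  poles : ∀ p ∈ S, ∃ N : ℕ, HasHolPoleAt f p N

/-- `f` is in `A⁰_E(⋆ S)` with at most simple (logarithmic) poles. -/
structure MemLog (τ : ℂ) (S : Finset ℂ) (f : ℂ → ℂ) : Prop extends MemPolar τ S f where
  simple : ∀ p ∈ S, HasHolPoleAt f p 1

/-! ### Holomorphic residues -/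

/-- The local holomorphic residue `res_∂ (f dz)` at `p` exists and equals `r`. -/
def HasResAt (f : ℂ → ℂ) (p r : ℂ) : Prop :=
  Filter.Tendsto (fun ε : ℝ => (2 * Real.pi * Complex.I : ℂ)⁻¹ * ∮ z in C(p, ε), f z)
    (𝓝[>] 0) (𝓝 r)

/-- `f` is smooth on `E` with holomorphic poles, and `res_∂ (f dz)`, the sum of all local
residues on `E`, equals `r`. -/
def HasRes (τ : ℂ) (f : ℂ → ℂ) (r : ℂ) : Prop :=
  ∃ (S : Finset ℂ) (ρ : ℂ → ℂ),
    (∀ p ∈ S, ∀ q ∈ S, p - q ∈ lattice τ → p = q) ∧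
    MemPolar τ S f ∧ (∀ p ∈ S, HasResAt f p (ρ p)) ∧ r = ∑ p ∈ S, ρ p

/-! ### Regularized integrals -/

/-- The Wirtinger derivative `∂_z`. -/
def dz (b : ℂ → ℂ) (z : ℂ) : ℂ :=
  (fderiv ℝ b z 1 - Complex.I * fderiv ℝ b z Complex.I) / 2

/-- `f` is smooth on `E` with holomorphic poles, and its regularized integral against
`vol = i / (2 im τ) dz ∧ dz̄` equals `I`: there is a decomposition
`f dz ∧ dz̄ = a dz ∧ dz̄ + ∂ (b dz̄)` such that `a` has only logarithmic poles, `b` is smooth with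
holomorphic poles, and `I` is the absolutely convergent integral `∫_E a vol`.  (In terms of Lebesgue
measure, `vol` is `dx dy / im τ`.) -/
def HasRegIntegral (τ : ℂ) (f : ℂ → ℂ) (I : ℂ) : Prop :=
  ∃ (S : Finset ℂ) (a b : ℂ → ℂ),
    MemPolar τ S f ∧ MemLog τ S a ∧ MemPolar τ S b ∧
    (∀ z ∉ poleSet τ S, f z = a z + dz b z) ∧
    MeasureTheory.IntegrableOn a (fundDomain τ) ∧
    I = (τ.im : ℂ)⁻¹ * ∫ z in fundDomain τ, a z

/-! ### Iteration -/

/-- The union of the divisors `z_k = t` and `z_k - z_l = t` (`k ≠ l`) in `E ^ n`, `t ∈ T`. -/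
def arrangement (τ : ℂ) (n : ℕ) (T : Finset ℂ) : Set (Fin n → ℂ) :=
  {w | ∃ t ∈ T, (∃ k, w k - t ∈ lattice τ) ∨ ∃ k l, k ≠ l ∧ w k - w l - t ∈ lattice τ}

/-- Iterate an operation on functions on `E`, given by its graph `R`, over the variables
`z_1, z_2, …, z_n` in this order (`z_1` first).  As usual for functions with poles, each
intermediate result `g` is a function off a divisor. -/
def HasIterated (τ : ℂ) (R : (ℂ → ℂ) → ℂ → Prop) :
    (n : ℕ) → ((Fin n → ℂ) → ℂ) → ℂ → Prop
  | 0, f, r => f Fin.elim0 = r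
  | n + 1, f, r => ∃ g : (Fin n → ℂ) → ℂ,
      (∃ T : Finset ℂ, ∀ w ∉ arrangement τ n T,
        R (fun z => f (Fin.cons z w : Fin (n + 1) → ℂ)) (g w)) ∧
      HasIterated τ R n g r

/-- The iterated residue `res_∂ dz_n ⋯ res_∂ dz_2 res_∂ (f dz_1)` exists and equals `r`. -/
def HasIterRes (τ : ℂ) (n : ℕ) (f : (Fin n → ℂ) → ℂ) (r : ℂ) : Prop :=
  HasIterated τ (HasRes τ) n f r

/-- The iterated regularized integral `⨍_{E_n} vol_n ⋯ ⨍_{E_1} f vol_1` exists and equals `I`. -/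
def HasIterRegIntegral (τ : ℂ) (n : ℕ) (f : (Fin n → ℂ) → ℂ) (I : ℂ) : Prop :=
  HasIterated τ (HasRegIntegral τ) n f I

/-! ### Chains and loops -/

/-- `s_{k,l} = c_{k,l} + z_k - z_l`. -/
def s {n : ℕ} (c : Fin n → Fin n → ℂ) (z : Fin n → ℂ) (k l : Fin n) : ℂ :=
  c k l + z k - z l

/-- `∏_{k < n} ê_{m_k}(s_{k,k+1}) · ê_{m_n}(z_n - z_0)`, with `z_0` a constant. -/
def xiChain (τ : ℂ) {n : ℕ} (c : Fin n → Fin n → ℂ) (z₀ : ℂ) (m : Fin n → ℕ)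
    (z : Fin n → ℂ) : ℂ :=
  ∏ k : Fin n, ehat τ (m k)
    (if h : (k : ℕ) + 1 < n then s c z k ⟨(k : ℕ) + 1, h⟩ else z k - z₀)

/-- `∏_k ê_{m_k}(s_{k,k+1})`, with `k + 1` taken cyclically. -/
def xiLoop (τ : ℂ) {n : ℕ} (c : Fin n → Fin n → ℂ) (m : Fin n → ℕ) (z : Fin n → ℂ) : ℂ :=
  ∏ k : Fin n, ehat τ (m k) (s c z k (finRotate n k))

/-- The Kronecker delta. -/
def kdelta (a b : ℕ) : ℂ := if a = b then 1 else 0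

end EllipticIterated

end

/-!
The functions `ê_m` form a tower under the antiholomorphic derivative: off the lattice,
`∂ê_{m+1} / ∂z̄ = Y ê_m` (`hasDbarAt_ehat_succ`), because `A(z)` has the constant derivative `Y` and
the rest of the generating function is holomorphic in `z`. They are periodic, have at most simple
poles, all on the lattice, and among them only `ê_1` has a nonzero residue, equal to `1`
(`hasSimplePole_ehat`). Everything else follows from these facts and Stokes' theorem.

*The theta function.* The formula `ê_m = ehatNum τ m / θ` with a smooth numerator (`ehat_eq`)
requires that `θ` vanishes on the lattice only, and to first order. Both are obtained from
`not_common_zero`: the entire functions with the periodicity of `ϑ²` form a space of dimension at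
most two, by comparison of Fourier coefficients. It contains the independent functions `ϑ²` and
`ϑ² ℘`, which are therefore a basis. An extra zero of `ϑ`, or a double zero at the origin, would be
a common zero of the basis, hence a zero of `ϑ(z - b) ϑ(z + b)` for all `b`.

*Stokes' theorem.* If `P` has at most simple poles, without residues, then its first derivatives are
`O(1 / |z - p|)` near a pole `p`, hence integrable, and by Fubini's theorem their integrals reduce
to integrals of derivatives of periodic functions over closed lines that avoid the poles. Residues
are removed by subtracting multiples of translates of `ê_1`. Hence, if `∂P / ∂z̄ = Y f`, the
regularized integral of `f` is the sum of the residues of `P` (`IsSimplePolar.hasRegIntegral`); here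
`f` itself has simple poles, so that no correction `∂ (b dz̄)` is needed.

*One variable.* A variable `z` of a chain occurs in one factor `ê_m(z - p)` only, with primitive
`ê_{m+1}(z - p)`. In a loop it occurs in a product `ê_k(z - p) ê_l(q - z)`, whose primitive
`∑_{i ≤ l} ê_{k+1+i}(z - p) ê_{l-i}(q - z)` telescopes (`hasDbarAt_pairPrimitive`). Its residues are
`δ_{k,0} ê_l(q - p)` at `p` and `(δ_{l,0} - 1) ê_{k+l}(q - p)` at `q`. So the residue and the
regularized integral in one variable turn a loop into a multiple of a loop with one variable less
(`hasIterated_loopFun_succ`), the sum of the shifts being preserved. The hypothesis on this sum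
keeps the two poles apart when only two variables are left; with more variables they are distinct
off a divisor `z_k - z_l = t`. A loop in one variable is a constant: its residue is `0`, its
regularized integral is its value.
-/

noncomputable section

namespace EllipticIterated

/-! ### Entire functions with the periodicity of the square of the theta function -/

/-- The integral of an entire `1`-periodic function over a period segment parallel to `[0, 1]` does
not depend on the segment. -/
lemma intervalIntegral_add_eq_of_entire_periodic {g : ℂ → ℂ} (hg : Differentiable ℂ g)
    (hper : ∀ z, g (z + 1) = g z) (w : ℂ) :
    ∫ x in (0 : ℝ)..1, g (x + w) = ∫ x in (0 : ℝ)..1, g x := by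
  have h1 : ∫ x in (0 : ℝ)..1, g (x + w.im * Complex.I) = ∫ x in (0 : ℝ)..1, g x := by
    have h := Complex.integral_boundary_rect_eq_zero_of_differentiableOn g 0
      (1 + w.im * Complex.I) hg.differentiableOn
    have h2 : ∀ y : ℝ, g (1 + y * Complex.I) = g (y * Complex.I) := fun y => by
      rw [add_comm, hper]
    simp [h2] at h
    linear_combination -h
  rw [← h1]
  have hp : Function.Periodic (fun x : ℝ => g (x + w.im * Complex.I)) 1 := fun x => by
    simp only [Complex.ofReal_add, Complex.ofReal_one]
    rw [add_right_comm, hper]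
  have h3 := hp.intervalIntegral_add_eq w.re 0
  simp only [zero_add] at h3
  rw [← h3]
  have h4 := intervalIntegral.integral_comp_add_right
    (fun x : ℝ => g (x + w.im * Complex.I)) (a := 0) (b := 1) w.re
  rw [zero_add, add_comm 1] at h4
  rw [← h4]
  congr 1 with x
  congr 1
  apply Complex.ext <;> simp

/-- The `n`-th Fourier coefficient on `[0, 1]` of a function on `ℂ`. -/
def fcoeff (f : ℂ → ℂ) (n : ℤ) : ℂ :=
  ∫ x in (0 : ℝ)..1, f x * Complex.exp (-2 * Real.pi * Complex.I * n * x)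

/-- An entire `1`-periodic function all of whose Fourier coefficients vanish is zero. -/
lemma eq_zero_of_fcoeff_eq_zero {f : ℂ → ℂ} (hf : Differentiable ℂ f)
    (hper : ∀ z, f (z + 1) = f z) (h0 : ∀ n, fcoeff f n = 0) (z : ℂ) : f z = 0 := by
  have hp : Function.Periodic (fun x : ℝ => f x) 1 := fun x => by
    simp [hper]
  have hc : Continuous hp.lift := by
    apply continuous_coinduced_dom.mpr
    exact hf.continuous.comp Complex.continuous_ofReal
  have : Fact ((0 : ℝ) < 1) := ⟨one_pos⟩
  let F : C(AddCircle (1 : ℝ), ℂ) := ⟨hp.lift, hc⟩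
  have hF : ∀ n, fourierCoeff F n = 0 := fun n => by
    rw [fourierCoeff_eq_intervalIntegral _ n 0, zero_add]
    have := h0 n
    rw [fcoeff] at this
    simp only [div_one, one_smul]
    rw [← this]
    congr 1 with x
    rw [fourier_coe_apply, smul_eq_mul, mul_comm]
    congr 1
    congr 1
    push_cast
    ring
  have hs : HasSum (fun n => fourierCoeff F n • fourier n) F :=
    hasSum_fourier_series_of_summable (by simp [funext hF])
  simp only [hF, zero_smul] at hs
  have hF0 : F = 0 := hs.unique hasSum_zero
  have hreal : ∀ x : ℝ, f x = 0 := fun x => by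
    have : F (x : AddCircle (1 : ℝ)) = 0 := by rw [hF0]; rfl
    simpa [F] using this
  have han : AnalyticOnNhd ℂ f Set.univ := fun z _ => hf.analyticAt z
  refine han.eqOn_zero_of_preconnected_of_frequently_eq_zero isPreconnected_univ
    (Set.mem_univ 0) ?_ (Set.mem_univ z)
  have ht : Filter.Tendsto (fun x : ℝ => (x : ℂ)) (𝓝[≠] 0) (𝓝[≠] 0) := by
    refine tendsto_nhdsWithin_iff.mpr ⟨?_, ?_⟩
    · exact (Complex.continuous_ofReal.tendsto' 0 0 (by simp)).mono_left nhdsWithin_le_nhds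
    · filter_upwards [self_mem_nhdsWithin] with x hx
      simpa using hx
  exact ht.frequently (Filter.Eventually.of_forall hreal).frequently

/-- A section of the square of the theta line bundle: an entire function with the periodicity of
`ϑ²`. -/
structure IsThetaSection (τ : ℂ) (f : ℂ → ℂ) : Prop where
  entire : Differentiable ℂ f
  add_one : ∀ z, f (z + 1) = f z
  add_tau : ∀ z, f (z + τ) = Complex.exp (-2 * Real.pi * Complex.I * τ
    - 4 * Real.pi * Complex.I * z) * f z

/-- Moving the segment of integration by `τ` relates the Fourier coefficients `n` and `n + 2`. -/
lemma IsThetaSection.fcoeff_add_two {τ : ℂ} {f : ℂ → ℂ} (hf : IsThetaSection τ f) (n : ℤ) :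
    fcoeff f n = Complex.exp (-2 * Real.pi * Complex.I * τ * (n + 1)) * fcoeff f (n + 2) := by
  have h := intervalIntegral_add_eq_of_entire_periodic
    (g := fun z => f z * Complex.exp (-2 * Real.pi * Complex.I * n * z))
    (hf.entire.mul (by fun_prop)) (fun z => by
      have := hf.add_one z
      rw [this, mul_add, Complex.exp_add]
      have h2 : -2 * Real.pi * Complex.I * n * 1 = ((-n : ℤ) : ℂ) * (2 * Real.pi * Complex.I) := by
        push_cast; ring
      rw [h2, Complex.exp_int_mul_two_pi_mul_I, mul_one]) τ
  rw [fcoeff, ← h, fcoeff, ← intervalIntegral.integral_const_mul]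
  congr 1 with x
  rw [hf.add_tau]
  have : ∀ a b c d e : ℂ, Complex.exp a * Complex.exp b = Complex.exp c * Complex.exp d →
      Complex.exp a * e * Complex.exp b = Complex.exp c * (e * Complex.exp d) := by
    intro a b c d e h
    linear_combination e * h
  apply this
  rw [← Complex.exp_add, ← Complex.exp_add]
  congr 1
  push_cast
  ring

lemma IsThetaSection.eq_zero {τ : ℂ} {f : ℂ → ℂ} (hf : IsThetaSection τ f)
    (h0 : fcoeff f 0 = 0) (h1 : fcoeff f 1 = 0) (z : ℂ) : f z = 0 := by
  have hup : ∀ n, fcoeff f n = 0 → fcoeff f (n + 2) = 0 := fun n hn => by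
    have := hf.fcoeff_add_two n
    rw [hn] at this
    simpa [Complex.exp_ne_zero] using this.symm
  have hdown : ∀ n, fcoeff f (n + 2) = 0 → fcoeff f n = 0 := fun n hn => by
    rw [hf.fcoeff_add_two n, hn, mul_zero]
  have key : ∀ n : ℤ, fcoeff f n = 0 ∧ fcoeff f (n + 1) = 0 := by
    intro n
    induction n using Int.induction_on with
    | zero => exact ⟨h0, by simpa using h1⟩
    | succ i ih => exact ⟨ih.2, by have := hup _ ih.1; rwa [add_assoc]⟩
    | pred i ih =>
      refine ⟨hdown _ ?_, by simpa using ih.1⟩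
      convert ih.2 using 2
      ring
  exact eq_zero_of_fcoeff_eq_zero hf.entire hf.add_one (fun n => (key n).1) z

lemma fcoeff_add {f g : ℂ → ℂ} (hf : Continuous f) (hg : Continuous g) (n : ℤ) :
    fcoeff (fun z => f z + g z) n = fcoeff f n + fcoeff g n := by
  rw [fcoeff, fcoeff, fcoeff, ← intervalIntegral.integral_add]
  · congr 1 with x
    ring
  all_goals
    apply Continuous.intervalIntegrable
    fun_prop

lemma fcoeff_const_mul (a : ℂ) (f : ℂ → ℂ) (n : ℤ) :
    fcoeff (fun z => a * f z) n = a * fcoeff f n := by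
  rw [fcoeff, fcoeff, ← intervalIntegral.integral_const_mul]
  congr 1 with x
  ring

lemma IsThetaSection.add {τ : ℂ} {f g : ℂ → ℂ} (hf : IsThetaSection τ f)
    (hg : IsThetaSection τ g) : IsThetaSection τ (fun z => f z + g z) :=
  ⟨hf.entire.add hg.entire, fun z => by rw [hf.add_one, hg.add_one], fun z => by
    rw [hf.add_tau, hg.add_tau]; ring⟩

lemma IsThetaSection.const_mul {τ : ℂ} {f : ℂ → ℂ} (a : ℂ) (hf : IsThetaSection τ f) :
    IsThetaSection τ (fun z => a * f z) :=
  ⟨hf.entire.const_mul a, fun z => by rw [hf.add_one], fun z => by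
    rw [hf.add_tau]; ring⟩

/-- The space of theta sections has dimension at most two: a section is determined by its Fourier
coefficients `0` and `1`. -/
lemma exists_linear_relation {τ : ℂ} {f g h : ℂ → ℂ} (hf : IsThetaSection τ f)
    (hg : IsThetaSection τ g) (hh : IsThetaSection τ h) :
    ∃ a b c : ℂ, (a ≠ 0 ∨ b ≠ 0 ∨ c ≠ 0) ∧ ∀ z, a * f z + b * g z + c * h z = 0 := by
  let M : Matrix (Fin 2) (Fin 3) ℂ :=
    !![fcoeff f 0, fcoeff g 0, fcoeff h 0; fcoeff f 1, fcoeff g 1, fcoeff h 1]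
  have hker : LinearMap.ker (Matrix.toLin' M) ≠ ⊥ :=
    LinearMap.ker_ne_bot_of_finrank_lt (by simp)
  obtain ⟨v, hv, hv0⟩ := (Submodule.ne_bot_iff _).mp hker
  rw [LinearMap.mem_ker, Matrix.toLin'_apply] at hv
  refine ⟨v 0, v 1, v 2, ?_, ?_⟩
  · by_contra hcon
    push Not at hcon
    apply hv0
    ext i
    fin_cases i
    · exact hcon.1
    · exact hcon.2.1
    · exact hcon.2.2
  · have key : ∀ n, fcoeff (fun z => v 0 * f z + v 1 * g z + v 2 * h z) n =
        v 0 * fcoeff f n + v 1 * fcoeff g n + v 2 * fcoeff h n := fun n => by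
      have cf := hf.entire.continuous
      have cg := hg.entire.continuous
      have ch := hh.entire.continuous
      rw [fcoeff_add (by fun_prop) (by fun_prop), fcoeff_add (by fun_prop) (by fun_prop),
        fcoeff_const_mul, fcoeff_const_mul, fcoeff_const_mul]
    have h0 := congrFun hv 0
    have h1 := congrFun hv 1
    simp [M, Matrix.mulVec, dotProduct, Fin.sum_univ_three] at h0 h1
    apply (((hf.const_mul (v 0)).add (hg.const_mul (v 1))).add (hh.const_mul (v 2))).eq_zero
    · rw [key]; linear_combination h0
    · rw [key]; linear_combination h1

/-! ### The period lattice -/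

/-- The period pair `(1, τ)`. -/
def periodPair {τ : ℂ} (hτ : 0 < τ.im) : PeriodPair where
  ω₁ := 1
  ω₂ := τ
  indep := by
    refine LinearIndependent.pair_iff.mpr fun s t h => ?_
    have him := congrArg Complex.im h
    have hre := congrArg Complex.re h
    simp at him hre
    rcases him with h0 | h0
    · subst h0
      simpa using hre
    · exact absurd h0 hτ.ne'

lemma mem_periodPair_lattice {τ : ℂ} (hτ : 0 < τ.im) {z : ℂ} :
    z ∈ (periodPair hτ).lattice ↔ z ∈ lattice τ := by
  rw [PeriodPair.mem_lattice]
  simp [lattice, periodPair, eq_comm]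

lemma lattice_eq_coe {τ : ℂ} (hτ : 0 < τ.im) :
    lattice τ = ((periodPair hτ).lattice : Set ℂ) :=
  Set.ext fun _ => (mem_periodPair_lattice hτ).symm

section Lattice

variable {τ : ℂ}

lemma zero_mem_lattice : (0 : ℂ) ∈ lattice τ := ⟨0, 0, by simp⟩

lemma one_mem_lattice : (1 : ℂ) ∈ lattice τ := ⟨1, 0, by simp⟩

lemma tau_mem_lattice : τ ∈ lattice τ := ⟨0, 1, by simp⟩

lemma add_mem_lattice {x y : ℂ} (hx : x ∈ lattice τ) (hy : y ∈ lattice τ) :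
    x + y ∈ lattice τ := by
  obtain ⟨a, b, rfl⟩ := hx
  obtain ⟨a', b', rfl⟩ := hy
  exact ⟨a + a', b + b', by push_cast; ring⟩

lemma neg_mem_lattice {x : ℂ} (hx : x ∈ lattice τ) : -x ∈ lattice τ := by
  obtain ⟨a, b, rfl⟩ := hx
  exact ⟨-a, -b, by push_cast; ring⟩

lemma sub_mem_lattice {x y : ℂ} (hx : x ∈ lattice τ) (hy : y ∈ lattice τ) :
    x - y ∈ lattice τ := by
  rw [sub_eq_add_neg]
  exact add_mem_lattice hx (neg_mem_lattice hy)

lemma add_mem_lattice_iff {x l : ℂ} (hl : l ∈ lattice τ) : x + l ∈ lattice τ ↔ x ∈ lattice τ :=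
  ⟨fun h => by simpa using sub_mem_lattice h hl, fun h => add_mem_lattice h hl⟩

lemma countable_lattice (τ : ℂ) : (lattice τ).Countable := by
  have : lattice τ = Set.range fun p : ℤ × ℤ => (p.1 : ℂ) + p.2 * τ := by
    ext z
    simp [lattice, eq_comm]
  rw [this]
  exact Set.countable_range _

lemma isClosed_lattice (hτ : 0 < τ.im) : IsClosed (lattice τ) :=
  lattice_eq_coe hτ ▸ (periodPair hτ).isClosed_lattice

lemma dense_compl_lattice (τ : ℂ) : Dense (lattice τ)ᶜ :=
  (countable_lattice τ).dense_compl ℝ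

/-- Periodicity under `1` and `τ` is periodicity under the lattice. -/
lemma periodic_of_one_tau {α : Type*} {f : ℂ → α} (h1 : ∀ z, f (z + 1) = f z)
    (h2 : ∀ z, f (z + τ) = f z) {l : ℂ} (hl : l ∈ lattice τ) (z : ℂ) : f (z + l) = f z := by
  obtain ⟨a, b, rfl⟩ := hl
  have p1 : Function.Periodic f ((a : ℂ) * 1) := Function.Periodic.int_mul h1 a
  have p2 : Function.Periodic f ((b : ℂ) * τ) := Function.Periodic.int_mul h2 b
  have := (p1.add_period p2) z
  rwa [mul_one] at this

/-- The lattice has no accumulation points. -/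
lemma eventually_notMem_lattice (hτ : 0 < τ.im) {p : ℂ} :
    ∀ᶠ z in 𝓝[≠] p, z ∉ lattice τ := by
  have h := (periodPair hτ).compl_lattice_sdiff_singleton_mem_nhds p
  rw [← lattice_eq_coe hτ] at h
  filter_upwards [nhdsWithin_le_nhds h, self_mem_nhdsWithin] with z hz hzp hzl
  exact hz ⟨hzl, hzp⟩

end Lattice

/-! ### Zeros of the theta function -/

section Theta

variable {τ : ℂ}

lemma differentiable_thetaChar (hτ : 0 < τ.im) : Differentiable ℂ (thetaChar τ) := by
  intro z
  unfold thetaChar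
  refine DifferentiableAt.mul (by fun_prop) ?_
  exact (differentiableAt_jacobiTheta₂_fst _ hτ).comp z (by fun_prop)

lemma thetaChar_neg (z : ℂ) : thetaChar τ (-z) = -thetaChar τ z := by
  unfold thetaChar
  have h1 : jacobiTheta₂ (-z + 1 / 2 + τ / 2) τ = jacobiTheta₂ (z - 1 / 2 - τ / 2) τ := by
    rw [← jacobiTheta₂_neg_left]
    congr 1
    ring
  have h2 : jacobiTheta₂ (z + 1 / 2 + τ / 2) τ =
      Complex.exp (-Real.pi * Complex.I * (2 * z + 1)) * jacobiTheta₂ (z - 1 / 2 - τ / 2) τ := by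
    rw [show z + 1 / 2 + τ / 2 = (z - 1 / 2 - τ / 2 + 1) + τ by ring, jacobiTheta₂_add_left',
      jacobiTheta₂_add_left]
    congr 2
    ring
  rw [h1, h2, ← mul_assoc, ← Complex.exp_add, ← neg_mul]
  congr 1
  rw [show Real.pi * Complex.I * τ / 4 + Real.pi * Complex.I * (-z + 1 / 2) =
    (Real.pi * Complex.I * τ / 4 + Real.pi * Complex.I * (z + 1 / 2) +
      -Real.pi * Complex.I * (2 * z + 1)) + Real.pi * Complex.I by ring,
    Complex.exp_add _ (Real.pi * Complex.I), Complex.exp_pi_mul_I, mul_neg_one]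

lemma thetaChar_zero : thetaChar τ 0 = 0 := by
  have h := thetaChar_neg (τ := τ) 0
  rw [neg_zero] at h
  linear_combination h / 2

lemma thetaChar_add_one (z : ℂ) : thetaChar τ (z + 1) = -thetaChar τ z := by
  unfold thetaChar
  rw [show z + 1 + 1 / 2 + τ / 2 = (z + 1 / 2 + τ / 2) + 1 by ring, jacobiTheta₂_add_left,
    show Real.pi * Complex.I * τ / 4 + Real.pi * Complex.I * (z + 1 + 1 / 2) =
      (Real.pi * Complex.I * τ / 4 + Real.pi * Complex.I * (z + 1 / 2)) + Real.pi * Complex.I by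
      ring, Complex.exp_add, Complex.exp_pi_mul_I]
  ring

lemma thetaChar_add_tau (z : ℂ) : thetaChar τ (z + τ) =
    -Complex.exp (-Real.pi * Complex.I * τ - 2 * Real.pi * Complex.I * z) * thetaChar τ z := by
  unfold thetaChar
  rw [show z + τ + 1 / 2 + τ / 2 = (z + 1 / 2 + τ / 2) + τ by ring, jacobiTheta₂_add_left',
    ← mul_assoc, ← mul_assoc, ← Complex.exp_add]
  congr 1
  rw [neg_mul (Complex.exp _), ← Complex.exp_add,
    show Real.pi * Complex.I * τ / 4 + Real.pi * Complex.I * (z + τ + 1 / 2) +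
        -Real.pi * Complex.I * (τ + 2 * (z + 1 / 2 + τ / 2)) =
      (-Real.pi * Complex.I * τ - 2 * Real.pi * Complex.I * z +
        (Real.pi * Complex.I * τ / 4 + Real.pi * Complex.I * (z + 1 / 2))) - Real.pi * Complex.I by
      ring, Complex.exp_sub, Complex.exp_pi_mul_I, div_neg, div_one]

lemma exists_jacobiTheta₂_ne_zero (hτ : 0 < τ.im) : ∃ z, jacobiTheta₂ z τ ≠ 0 := by
  by_contra! hcon
  have hi : ∫ x in (0 : ℝ)..1, jacobiTheta₂ x τ = 1 := by
    have hS : HasSum (fun n : ℤ => ∫ x in (0 : ℝ)..1, jacobiTheta₂_term n x τ)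
        (∫ x in (0 : ℝ)..1, jacobiTheta₂ x τ) := by
      refine intervalIntegral.hasSum_integral_of_dominated_convergence
        (fun n _ => ‖jacobiTheta₂_term n 0 τ‖) ?_ ?_ ?_ ?_ ?_
      · intro n
        apply Continuous.aestronglyMeasurable
        unfold jacobiTheta₂_term
        fun_prop
      · intro n
        filter_upwards with x _
        simp [norm_jacobiTheta₂_term]
      · filter_upwards with x _
        exact ((summable_jacobiTheta₂_term_iff 0 τ).mpr hτ).norm
      · exact intervalIntegrable_const
      · filter_upwards with x _
        exact hasSum_jacobiTheta₂_term x hτ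
    have hterm : ∀ n : ℤ, n ≠ 0 → ∫ x in (0 : ℝ)..1, jacobiTheta₂_term n x τ = 0 := by
      intro n hn
      have hne : 2 * Real.pi * Complex.I * n ≠ 0 := by
        simp [Complex.I_ne_zero, Real.pi_ne_zero, hn]
      have := integral_exp_mul_complex (a := 0) (b := 1) hne
      simp only [jacobiTheta₂_term, Complex.exp_add]
      rw [intervalIntegral.integral_mul_const, this]
      have h1 : Complex.exp (2 * Real.pi * Complex.I * n) = 1 := by
        rw [mul_comm]
        exact Complex.exp_int_mul_two_pi_mul_I n
      simp [h1]
    have h2 := hS.unique (hasSum_single 0 hterm)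
    rw [h2]
    simp [jacobiTheta₂_term]
  simp [hcon] at hi

lemma exists_thetaChar_ne_zero (hτ : 0 < τ.im) : ∃ z, thetaChar τ z ≠ 0 := by
  obtain ⟨z, hz⟩ := exists_jacobiTheta₂_ne_zero hτ
  refine ⟨z - 1 / 2 - τ / 2, ?_⟩
  unfold thetaChar
  rw [show z - 1 / 2 - τ / 2 + 1 / 2 + τ / 2 = z by ring]
  exact mul_ne_zero (Complex.exp_ne_zero _) hz

lemma isThetaSection_translates (hτ : 0 < τ.im) (b : ℂ) :
    IsThetaSection τ (fun z => thetaChar τ (z - b) * thetaChar τ (z + b)) where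
  entire := by
    have := differentiable_thetaChar hτ
    fun_prop
  add_one z := by
    rw [add_sub_right_comm, add_right_comm, thetaChar_add_one, thetaChar_add_one]
    ring
  add_tau z := by
    rw [add_sub_right_comm, add_right_comm, thetaChar_add_tau, thetaChar_add_tau]
    rw [show -2 * Real.pi * Complex.I * τ - 4 * Real.pi * Complex.I * z =
      (-Real.pi * Complex.I * τ - 2 * Real.pi * Complex.I * (z - b)) +
      (-Real.pi * Complex.I * τ - 2 * Real.pi * Complex.I * (z + b)) by ring, Complex.exp_add]
    ring

lemma thetaChar_eq_zero_of_mem {l : ℂ} (hl : l ∈ lattice τ) :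
    thetaChar τ l = 0 := by
  have h := periodic_of_one_tau (τ := τ) (f := fun z => thetaChar τ z = 0)
    (fun z => by simp [thetaChar_add_one]) (fun z => by
      simp [thetaChar_add_tau, Complex.exp_ne_zero]) hl 0
  simp only [zero_add, thetaChar_zero] at h
  simpa using h

open Classical in
/-- The entire function `ϑ² ℘`; its value at a lattice point is the limit `ϑ'²`. -/
def thetaSqP (hτ : 0 < τ.im) (z : ℂ) : ℂ :=
  if z ∈ lattice τ then deriv (thetaChar τ) z ^ 2
  else thetaChar τ z ^ 2 * (periodPair hτ).weierstrassP z

/-- Near a lattice point `l`, the double pole of `℘` is cancelled by the double zero of `ϑ²`. -/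
lemma thetaSqP_eventuallyEq (hτ : 0 < τ.im) {l : ℂ} (hl : l ∈ lattice τ) :
    thetaSqP hτ =ᶠ[𝓝 l] fun z => thetaChar τ z ^ 2 *
      ((periodPair hτ).weierstrassPExcept l z - 1 / l ^ 2) + dslope (thetaChar τ) l z ^ 2 := by
  have h := (periodPair hτ).compl_lattice_sdiff_singleton_mem_nhds l
  rw [← lattice_eq_coe hτ] at h
  filter_upwards [h] with z hz
  by_cases hzl : z = l
  · subst hzl
    simp [thetaSqP, hl, thetaChar_eq_zero_of_mem hl]
  · have hz' : z ∉ lattice τ := fun hm => hz ⟨hm, hzl⟩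
    have hne : z - l ≠ 0 := sub_ne_zero.mpr hzl
    rw [thetaSqP, if_neg hz', ← (periodPair hτ).weierstrassPExcept_add
      ⟨l, (mem_periodPair_lattice hτ).mpr hl⟩, dslope_of_ne _ hzl, slope_def_field,
      thetaChar_eq_zero_of_mem hl]
    field_simp
    ring

lemma differentiable_thetaSqP (hτ : 0 < τ.im) : Differentiable ℂ (thetaSqP hτ) := by
  intro z
  have hd := differentiable_thetaChar hτ
  by_cases hz : z ∈ lattice τ
  · refine DifferentiableAt.congr_of_eventuallyEq ?_ (thetaSqP_eventuallyEq hτ hz)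
    have h1 := ((periodPair hτ).differentiableOn_weierstrassPExcept z).differentiableAt
      ((periodPair hτ).compl_lattice_sdiff_singleton_mem_nhds z)
    have h2 : DifferentiableAt ℂ (dslope (thetaChar τ) z) z :=
      ((Complex.differentiableOn_dslope (s := Set.univ) Filter.univ_mem).mpr
        hd.differentiableOn).differentiableAt Filter.univ_mem
    fun_prop
  · have hn : (lattice τ)ᶜ ∈ 𝓝 z := (isClosed_lattice hτ).isOpen_compl.mem_nhds hz
    have h1 : DifferentiableAt ℂ (periodPair hτ).weierstrassP z := by
      refine (periodPair hτ).differentiableOn_weierstrassP.differentiableAt ?_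
      rwa [← lattice_eq_coe hτ]
    have : thetaSqP hτ =ᶠ[𝓝 z] fun z => thetaChar τ z ^ 2 * (periodPair hτ).weierstrassP z := by
      filter_upwards [hn] with w hw
      exact if_neg hw
    refine DifferentiableAt.congr_of_eventuallyEq ?_ this
    fun_prop

lemma weierstrassP_add_of_mem (hτ : 0 < τ.im) (z : ℂ) {l : ℂ} (hl : l ∈ lattice τ) :
    (periodPair hτ).weierstrassP (z + l) = (periodPair hτ).weierstrassP z :=
  (periodPair hτ).weierstrassP_add_coe z ⟨l, (mem_periodPair_lattice hτ).mpr hl⟩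

lemma isThetaSection_thetaSqP (hτ : 0 < τ.im) : IsThetaSection τ (thetaSqP hτ) where
  entire := differentiable_thetaSqP hτ
  add_one z := by
    have hc := (differentiable_thetaSqP hτ).continuous
    refine congrFun (Continuous.ext_on (dense_compl_lattice τ)
      (f := fun z => thetaSqP hτ (z + 1)) (by fun_prop) hc fun w hw => ?_) z
    have hw1 : w + 1 ∉ lattice τ := fun h => hw ((add_mem_lattice_iff one_mem_lattice).mp h)
    simp only [thetaSqP]
    rw [if_neg hw, if_neg hw1, thetaChar_add_one, weierstrassP_add_of_mem hτ w one_mem_lattice]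
    ring
  add_tau z := by
    have hc := (differentiable_thetaSqP hτ).continuous
    refine congrFun (Continuous.ext_on (dense_compl_lattice τ)
      (f := fun z => thetaSqP hτ (z + τ)) (g := fun z => Complex.exp (-2 * Real.pi * Complex.I * τ
        - 4 * Real.pi * Complex.I * z) * thetaSqP hτ z) (by fun_prop) (by fun_prop)
        fun w hw => ?_) z
    have hw1 : w + τ ∉ lattice τ := fun h => hw ((add_mem_lattice_iff tau_mem_lattice).mp h)
    simp only [thetaSqP]
    rw [if_neg hw, if_neg hw1, thetaChar_add_tau, weierstrassP_add_of_mem hτ w tau_mem_lattice]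
    rw [show -2 * Real.pi * Complex.I * τ - 4 * Real.pi * Complex.I * w =
      (-Real.pi * Complex.I * τ - 2 * Real.pi * Complex.I * w) +
      (-Real.pi * Complex.I * τ - 2 * Real.pi * Complex.I * w) by ring, Complex.exp_add]
    ring

/-- The sections `ϑ²` and `ϑ² ℘` have no common zero; otherwise it would be a zero of the
translates `ϑ(z - b) ϑ(z + b)` for every `b`, since these lie in the span of the two. -/
lemma not_common_zero (hτ : 0 < τ.im) (a : ℂ) :
    ¬ (thetaChar τ a = 0 ∧ thetaSqP hτ a = 0) := by
  rintro ⟨ha, ha'⟩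
  have hd := differentiable_thetaChar hτ
  obtain ⟨z₀, hz₀⟩ := exists_thetaChar_ne_zero hτ
  have han : AnalyticOnNhd ℂ (thetaChar τ) Set.univ := fun z _ => hd.analyticAt z
  obtain ⟨b, hb⟩ : ∃ b, thetaChar τ (a - b) * thetaChar τ (a + b) ≠ 0 := by
    by_contra! hcon
    have h1 : AnalyticOnNhd ℂ (fun b => thetaChar τ (a - b)) Set.univ := fun z _ =>
      (show Differentiable ℂ (fun b => thetaChar τ (a - b)) by fun_prop).analyticAt z
    have h2 : AnalyticOnNhd ℂ (fun b => thetaChar τ (a + b)) Set.univ := fun z _ =>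
      (show Differentiable ℂ (fun b => thetaChar τ (a + b)) by fun_prop).analyticAt z
    rcases h1.eq_zero_or_eq_zero_of_mul_eq_zero h2 (fun b _ => hcon b) isPreconnected_univ
      with h | h
    · exact hz₀ (by simpa using h (a - z₀) (Set.mem_univ _))
    · exact hz₀ (by simpa using h (z₀ - a) (Set.mem_univ _))
  have hsq : IsThetaSection τ (fun z => thetaChar τ z * thetaChar τ z) := by
    simpa using isThetaSection_translates hτ 0
  obtain ⟨x, y, w, hne, hrel⟩ := exists_linear_relation (isThetaSection_translates hτ b) hsq
    (isThetaSection_thetaSqP hτ)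
  have hx : x = 0 := by
    have := hrel a
    simp only [ha, ha', mul_zero, add_zero] at this
    exact (mul_eq_zero.mp this).resolve_right hb
  subst hx
  simp only [zero_mul, zero_add] at hrel
  have hw : w ≠ 0 := by
    rintro rfl
    have hy : y ≠ 0 := by simpa using hne
    have := hrel z₀
    simp [hy, hz₀] at this
  -- Comparison of the orders at the origin: with `D = ϑ(z) / z`, the relation reads
  -- `D² (w + z² (…)) = 0`, so that `D`, hence `ϑ`, vanishes near the origin.
  have hD : ∀ᶠ z in 𝓝 (0 : ℂ), thetaChar τ z = 0 := by
    have h0 := thetaSqP_eventuallyEq hτ (zero_mem_lattice (τ := τ))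
    have h1 := ((periodPair hτ).differentiableOn_weierstrassPExcept 0).differentiableAt
      ((periodPair hτ).compl_lattice_sdiff_singleton_mem_nhds 0)
    have h2 : ContinuousAt (fun z => y * z ^ 2 +
        w * (z ^ 2 * (periodPair hτ).weierstrassPExcept 0 z + 1)) 0 := by
      have := h1.continuousAt
      fun_prop
    have h3 := h2.eventually_ne (y := 0) (by simpa using hw)
    filter_upwards [h0, h3] with z hz hz3
    have hθ : thetaChar τ z = z * dslope (thetaChar τ) 0 z := by
      have := sub_smul_dslope (thetaChar τ) 0 z
      simp only [thetaChar_zero, sub_zero, smul_eq_mul] at this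
      exact this.symm
    have h4 := hrel z
    rw [hz, hθ] at h4
    have h5 : dslope (thetaChar τ) 0 z ^ 2 * (y * z ^ 2 +
        w * (z ^ 2 * (periodPair hτ).weierstrassPExcept 0 z + 1)) = 0 := by
      simp only [ne_eq, OfNat.ofNat_ne_zero, not_false_eq_true, zero_pow, div_zero, sub_zero] at h4
      linear_combination h4
    have h6 : dslope (thetaChar τ) 0 z = 0 := by
      simpa using (mul_eq_zero.mp h5).resolve_right hz3
    rw [hθ, h6, mul_zero]
  exact hz₀ (han.eqOn_zero_of_preconnected_of_eventuallyEq_zero isPreconnected_univ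
    (Set.mem_univ 0) hD (Set.mem_univ z₀))

lemma thetaChar_ne_zero (hτ : 0 < τ.im) {z : ℂ} (hz : z ∉ lattice τ) : thetaChar τ z ≠ 0 :=
  fun h => not_common_zero hτ z ⟨h, by simp [thetaSqP, hz, h]⟩

lemma deriv_thetaChar_ne_zero (hτ : 0 < τ.im) : deriv (thetaChar τ) 0 ≠ 0 :=
  fun h => not_common_zero hτ 0 ⟨thetaChar_zero, by simp [thetaSqP, zero_mem_lattice, h]⟩

lemma differentiable_theta (hτ : 0 < τ.im) : Differentiable ℂ (theta τ) :=
  (differentiable_thetaChar hτ).div_const _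

lemma theta_zero : theta τ 0 = 0 := by simp [theta, thetaChar_zero]

lemma theta_ne_zero (hτ : 0 < τ.im) {z : ℂ} (hz : z ∉ lattice τ) : theta τ z ≠ 0 :=
  div_ne_zero (thetaChar_ne_zero hτ hz) (deriv_thetaChar_ne_zero hτ)

lemma deriv_theta_zero (hτ : 0 < τ.im) : deriv (theta τ) 0 = 1 := by
  unfold theta
  rw [deriv_div_const, div_self (deriv_thetaChar_ne_zero hτ)]

lemma theta_add_one (z : ℂ) : theta τ (z + 1) = -theta τ z := by
  simp [theta, thetaChar_add_one, neg_div]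

lemma theta_add_tau (z : ℂ) : theta τ (z + τ) =
    -Complex.exp (-Real.pi * Complex.I * τ - 2 * Real.pi * Complex.I * z) * theta τ z := by
  rw [theta, thetaChar_add_tau, theta, mul_div_assoc]

end Theta

/-! ### Taylor coefficients at the origin -/

section TaylorCoeff

/-- The `m`-th Taylor coefficient of `f` at `0`. -/
def taylorCoeff (f : ℂ → ℂ) (m : ℕ) : ℂ := iteratedDeriv m f 0 / (m.factorial : ℂ)

lemma taylorCoeff_congr {f g : ℂ → ℂ} (h : f =ᶠ[𝓝 0] g) (m : ℕ) :
    taylorCoeff f m = taylorCoeff g m := by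
  rw [taylorCoeff, h.iteratedDeriv_eq, taylorCoeff]

lemma taylorCoeff_mul {f g : ℂ → ℂ} (hf : AnalyticAt ℂ f 0) (hg : AnalyticAt ℂ g 0) (m : ℕ) :
    taylorCoeff (fun z => f z * g z) m =
      ∑ p ∈ Finset.HasAntidiagonal.antidiagonal m, taylorCoeff f p.1 * taylorCoeff g p.2 := by
  rw [taylorCoeff, iteratedDeriv_fun_mul hf.contDiffAt hg.contDiffAt, Finset.sum_div,
    Finset.Nat.sum_antidiagonal_eq_sum_range_succ
      (fun i j => taylorCoeff f i * taylorCoeff g j)]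
  refine Finset.sum_congr rfl fun i hi => ?_
  have him : i ≤ m := Nat.lt_succ_iff.mp (Finset.mem_range.mp hi)
  have h1 : ((m.choose i : ℕ) : ℂ) * (i.factorial : ℂ) * ((m - i).factorial : ℂ) =
      (m.factorial : ℂ) := by
    exact_mod_cast Nat.choose_mul_factorial_mul_factorial him
  have hi0 : (i.factorial : ℂ) ≠ 0 := by exact_mod_cast i.factorial_ne_zero
  have hmi0 : ((m - i).factorial : ℂ) ≠ 0 := by exact_mod_cast (m - i).factorial_ne_zero
  have hm0 : (m.factorial : ℂ) ≠ 0 := by exact_mod_cast m.factorial_ne_zero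
  rw [taylorCoeff, taylorCoeff, div_mul_div_comm, div_eq_div_iff hm0 (mul_ne_zero hi0 hmi0), ← h1]
  ring

lemma taylorCoeff_const_mul (a : ℂ) (f : ℂ → ℂ) (m : ℕ) :
    taylorCoeff (fun z => a * f z) m = a * taylorCoeff f m := by
  rw [taylorCoeff, iteratedDeriv_const_mul_field, taylorCoeff, mul_div_assoc]

lemma taylorCoeff_exp (a : ℂ) (m : ℕ) :
    taylorCoeff (fun c => Complex.exp (c * a)) m = a ^ m / (m.factorial : ℂ) := by
  simp_rw [mul_comm _ a]
  rw [taylorCoeff, iteratedDeriv_cexp_const_mul]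
  simp

lemma taylorCoeff_id (m : ℕ) : taylorCoeff (fun c => c) m = kdelta m 1 := by
  rw [taylorCoeff, iteratedDeriv_fun_id_zero, kdelta]
  split_ifs with h <;> simp [h]

end TaylorCoeff

/-! ### Eisenstein–Kronecker functions as quotients by the theta function -/

section Numerator

variable {τ : ℂ}

/-- The function `c / θ(c)`, regular at the origin. -/
def thetaInv (τ c : ℂ) : ℂ := (dslope (theta τ) 0 c)⁻¹

lemma dslope_theta_zero (hτ : 0 < τ.im) : dslope (theta τ) 0 0 = 1 := by
  rw [dslope_same, deriv_theta_zero hτ]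

lemma mul_dslope_theta (z : ℂ) : z * dslope (theta τ) 0 z = theta τ z := by
  have := sub_smul_dslope (theta τ) 0 z
  simpa [theta_zero] using this

lemma differentiable_dslope_theta (hτ : 0 < τ.im) : Differentiable ℂ (dslope (theta τ) 0) :=
  fun _ => ((Complex.differentiableOn_dslope (s := Set.univ) Filter.univ_mem).mpr
    (differentiable_theta hτ).differentiableOn).differentiableAt Filter.univ_mem

lemma analyticAt_thetaInv (hτ : 0 < τ.im) : AnalyticAt ℂ (thetaInv τ) 0 :=
  ((differentiable_dslope_theta hτ).analyticAt 0).inv (by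
    rw [dslope_theta_zero hτ]
    exact one_ne_zero)

/-- The `j`-th Taylor coefficient in `c` of `c θ(z + c) / θ(c)`. -/
def numCoeff (τ : ℂ) (j : ℕ) (z : ℂ) : ℂ :=
  ∑ p ∈ Finset.HasAntidiagonal.antidiagonal j,
    iteratedDeriv p.1 (theta τ) z / (p.1.factorial : ℂ) * taylorCoeff (thetaInv τ) p.2

/-- The numerator of `ê_m`: the `m`-th Taylor coefficient in `c` of
`exp (c A(z)) c θ(z + c) / θ(c)`. -/
def ehatNum (τ : ℂ) (m : ℕ) (z : ℂ) : ℂ :=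
  ∑ p ∈ Finset.HasAntidiagonal.antidiagonal m,
    Afun τ z ^ p.1 / (p.1.factorial : ℂ) * numCoeff τ p.2 z

lemma taylorCoeff_theta_mul_thetaInv (hτ : 0 < τ.im) (j : ℕ) (z : ℂ) :
    taylorCoeff (fun c => theta τ (z + c) * thetaInv τ c) j = numCoeff τ j z := by
  have h1 : AnalyticAt ℂ (fun c => theta τ (z + c)) 0 := by
    have := differentiable_theta hτ
    exact (show Differentiable ℂ fun c => theta τ (z + c) by fun_prop).analyticAt 0
  rw [taylorCoeff_mul h1 (analyticAt_thetaInv hτ), numCoeff]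
  refine Finset.sum_congr rfl fun p _ => ?_
  rw [taylorCoeff, iteratedDeriv_comp_const_add]
  simp only [add_zero]

lemma ehat_eq (hτ : 0 < τ.im) (m : ℕ) {z : ℂ} (hz : z ∉ lattice τ) :
    ehat τ m z = ehatNum τ m z / theta τ z := by
  have hθ := theta_ne_zero hτ hz
  have h1 : AnalyticAt ℂ (fun c => theta τ (z + c)) 0 := by
    have := differentiable_theta hτ
    exact (show Differentiable ℂ fun c => theta τ (z + c) by fun_prop).analyticAt 0
  have h2 : AnalyticAt ℂ (fun c => Complex.exp (c * Afun τ z)) 0 := by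
    exact (show Differentiable ℂ fun c => Complex.exp (c * Afun τ z) by fun_prop).analyticAt 0
  have h3 : AnalyticAt ℂ (fun c => theta τ (z + c) * thetaInv τ c) 0 :=
    h1.mul (analyticAt_thetaInv hτ)
  -- The removable singularity at `c = 0` is filled by the divided difference `dslope`, whose value
  -- `θ'(0) = 1` matches the prescribed value, so that this identity holds for all `c`.
  have hfun : Function.update (fun c : ℂ => c * Shat τ c z) 0 1 = fun c =>
      (theta τ z)⁻¹ * (Complex.exp (c * Afun τ z) * (theta τ (z + c) * thetaInv τ c)) := by
    funext c
    by_cases hc : c = 0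
    · subst hc
      simp [thetaInv, deriv_theta_zero hτ, hθ]
    · rw [Function.update_of_ne hc, Shat, thetaInv, dslope_of_ne _ hc, slope_def_field, theta_zero,
        sub_zero, sub_zero, inv_div]
      simp only [div_eq_mul_inv, mul_inv]
      ring
  have : ehat τ m z = taylorCoeff (Function.update (fun c : ℂ => c * Shat τ c z) 0 1) m := rfl
  rw [this, hfun, taylorCoeff_const_mul, taylorCoeff_mul h2 h3,
    div_eq_inv_mul, ehatNum]
  simp_rw [taylorCoeff_exp, taylorCoeff_theta_mul_thetaInv hτ]

lemma ehat_zero (z : ℂ) : ehat τ 0 z = 1 := by simp [ehat]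

lemma Afun_zero : Afun τ 0 = 0 := by simp [Afun]

lemma ehatNum_apply_zero (hτ : 0 < τ.im) (m : ℕ) : ehatNum τ m 0 = kdelta m 1 := by
  rw [ehatNum, Finset.sum_eq_single (0, m)]
  · rw [← taylorCoeff_theta_mul_thetaInv hτ, ← taylorCoeff_id]
    simp only [Afun_zero, pow_zero, Nat.factorial_zero, Nat.cast_one, div_one, one_mul, zero_add]
    apply taylorCoeff_congr
    have hne := (differentiable_dslope_theta hτ).continuous.continuousAt (x := 0) |>.eventually_ne
      (y := 0) (by rw [dslope_theta_zero hτ]; exact one_ne_zero)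
    filter_upwards [hne] with c hc
    rw [← mul_dslope_theta, thetaInv, mul_assoc, mul_inv_cancel₀ hc, mul_one]
  · rintro ⟨i, j⟩ hp hne
    have hi : i ≠ 0 := by
      rintro rfl
      simp_all
    simp [Afun_zero, hi]
  · simp

lemma differentiable_numCoeff (hτ : 0 < τ.im) (j : ℕ) : Differentiable ℂ (numCoeff τ j) := by
  intro z
  unfold numCoeff
  refine DifferentiableAt.fun_sum fun p _ => ?_
  have hd : Differentiable ℂ (iteratedDeriv p.1 (theta τ)) :=
    (differentiable_theta hτ).contDiff.differentiable_iteratedDeriv (n := ⊤) _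
      (by exact_mod_cast WithTop.coe_lt_top _)
  exact ((hd z).div_const _).mul_const _

lemma contDiff_Afun (τ : ℂ) : ContDiff ℝ ∞ (Afun τ) := by
  have : ContDiff ℝ ∞ (starRingEnd ℂ : ℂ → ℂ) := Complex.conjCLE.contDiff
  unfold Afun
  fun_prop

lemma contDiff_ehatNum (hτ : 0 < τ.im) (m : ℕ) : ContDiff ℝ ∞ (ehatNum τ m) := by
  unfold ehatNum
  refine ContDiff.sum fun p _ => ContDiff.mul (((contDiff_Afun τ).pow _).div_const _) ?_
  exact (differentiable_numCoeff hτ _).contDiff.restrict_scalars ℝ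

lemma contDiff_theta (hτ : 0 < τ.im) : ContDiff ℝ ∞ (theta τ) :=
  (differentiable_theta hτ).contDiff.restrict_scalars ℝ

lemma contDiffAt_ehat (hτ : 0 < τ.im) (m : ℕ) {z : ℂ} (hz : z ∉ lattice τ) :
    ContDiffAt ℝ ∞ (ehat τ m) z := by
  have h : ContDiffAt ℝ ∞ (fun z => ehatNum τ m z * (theta τ z)⁻¹) z :=
    (contDiff_ehatNum hτ m).contDiffAt.mul
      ((contDiff_theta hτ).contDiffAt.inv (theta_ne_zero hτ hz))
  refine h.congr_of_eventuallyEq ?_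
  filter_upwards [(isClosed_lattice hτ).isOpen_compl.mem_nhds hz] with w hw
  rw [ehat_eq hτ m hw, div_eq_mul_inv]

lemma Afun_add_one (z : ℂ) : Afun τ (z + 1) = Afun τ z := by
  simp [Afun]

lemma Afun_add_tau (hτ : 0 < τ.im) (z : ℂ) :
    Afun τ (z + τ) = Afun τ z + 2 * Real.pi * Complex.I := by
  have h1 : (starRingEnd ℂ) τ - τ = -(2 * τ.im * Complex.I) := by
    apply Complex.ext
    · simp
    · simp
      ring
  have h2 : (τ.im : ℂ) ≠ 0 := by exact_mod_cast hτ.ne'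
  have h3 : Yconst τ * ((starRingEnd ℂ) τ - τ) = 2 * Real.pi * Complex.I := by
    rw [h1, Yconst]
    field_simp
  simp only [Afun, map_add]
  linear_combination h3

lemma Shat_add_one (c z : ℂ) : Shat τ c (z + 1) = Shat τ c z := by
  rw [Shat, Shat, Afun_add_one, add_right_comm, theta_add_one, theta_add_one, neg_mul,
    neg_div_neg_eq]

lemma Shat_add_tau (hτ : 0 < τ.im) (c z : ℂ) : Shat τ c (z + τ) = Shat τ c z := by
  rw [Shat, Shat, Afun_add_tau hτ, add_right_comm, theta_add_tau, theta_add_tau]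
  have h1 : Complex.exp (c * (Afun τ z + 2 * Real.pi * Complex.I)) =
      Complex.exp (c * Afun τ z) * Complex.exp (c * (2 * Real.pi * Complex.I)) := by
    rw [← Complex.exp_add, mul_add]
  have h2 : Complex.exp (-Real.pi * Complex.I * τ - 2 * Real.pi * Complex.I * (z + c)) =
      Complex.exp (-Real.pi * Complex.I * τ - 2 * Real.pi * Complex.I * z) *
        (Complex.exp (c * (2 * Real.pi * Complex.I)))⁻¹ := by
    rw [← Complex.exp_neg, ← Complex.exp_add]
    congr 1
    ring
  have h3 := Complex.exp_ne_zero (-Real.pi * Complex.I * τ - 2 * Real.pi * Complex.I * z)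
  have h4 := Complex.exp_ne_zero (c * (2 * Real.pi * Complex.I))
  rw [h1, h2, mul_assoc (Complex.exp (c * Afun τ z))]
  congr 1
  rw [← mul_div_assoc, mul_assoc (-Complex.exp _) (theta τ z), ← mul_div_mul_left _
    (theta τ z * theta τ c) (neg_ne_zero.mpr h3)]
  congr 1
  field_simp

lemma ehat_add_of_mem (hτ : 0 < τ.im) (m : ℕ) (z : ℂ) {l : ℂ} (hl : l ∈ lattice τ) :
    ehat τ m (z + l) = ehat τ m z :=
  periodic_of_one_tau (fun z => by simp only [ehat, Shat_add_one])
    (fun z => by simp only [ehat, Shat_add_tau hτ]) hl z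

end Numerator

/-! ### The antiholomorphic derivative -/

section Dbar

/-- The function `f` is real differentiable at `z` and its Wirtinger derivative `∂f / ∂z̄` is
`d`. -/
def HasDbarAt (f : ℂ → ℂ) (d z : ℂ) : Prop :=
  ∃ D : ℂ →L[ℝ] ℂ, HasFDerivAt f D z ∧ (D 1 + Complex.I * D Complex.I) / 2 = d

variable {f g : ℂ → ℂ} {d e z : ℂ}

lemma HasDbarAt.congr_of_eventuallyEq (h : HasDbarAt f d z) (hfg : g =ᶠ[𝓝 z] f) :
    HasDbarAt g d z := by
  obtain ⟨D, hD, hd⟩ := h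
  exact ⟨D, hD.congr_of_eventuallyEq hfg, hd⟩

lemma HasDbarAt.add (hf : HasDbarAt f d z) (hg : HasDbarAt g e z) :
    HasDbarAt (fun z => f z + g z) (d + e) z := by
  obtain ⟨D, hD, rfl⟩ := hf
  obtain ⟨D', hD', rfl⟩ := hg
  refine ⟨D + D', hD.add hD', ?_⟩
  simp only [_root_.add_apply]
  ring

lemma HasDbarAt.mul (hf : HasDbarAt f d z) (hg : HasDbarAt g e z) :
    HasDbarAt (fun z => f z * g z) (d * g z + f z * e) z := by
  obtain ⟨D, hD, rfl⟩ := hf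
  obtain ⟨D', hD', rfl⟩ := hg
  refine ⟨_, hD.mul hD', ?_⟩
  simp only [_root_.add_apply, _root_.smul_apply, smul_eq_mul]
  ring

lemma hasDbarAt_of_differentiableAt (hf : DifferentiableAt ℂ f z) : HasDbarAt f 0 z := by
  refine ⟨_, hf.hasFDerivAt.restrictScalars ℝ, ?_⟩
  simp only [ContinuousLinearMap.coe_restrictScalars']
  have : fderiv ℂ f z Complex.I = Complex.I * fderiv ℂ f z 1 := by
    rw [← smul_eq_mul, ← map_smul, smul_eq_mul, mul_one]
  rw [this, ← mul_assoc, Complex.I_mul_I]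
  ring

lemma hasDbarAt_const (a z : ℂ) : HasDbarAt (fun _ => a) 0 z :=
  hasDbarAt_of_differentiableAt (by fun_prop)

lemma HasDbarAt.const_mul (a : ℂ) (hf : HasDbarAt f d z) :
    HasDbarAt (fun z => a * f z) (a * d) z := by
  simpa using (hasDbarAt_const a z).mul hf

lemma HasDbarAt.sum {ι : Type*} {s : Finset ι} {f : ι → ℂ → ℂ} {d : ι → ℂ}
    (h : ∀ i ∈ s, HasDbarAt (f i) (d i) z) :
    HasDbarAt (fun z => ∑ i ∈ s, f i z) (∑ i ∈ s, d i) z := by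
  classical
  induction s using Finset.induction_on with
  | empty => simpa using hasDbarAt_const 0 z
  | insert a s ha ih =>
    simp only [Finset.sum_insert ha]
    exact (h a (by simp)).add (ih fun i hi => h i (by simp [hi]))

lemma HasDbarAt.comp_sub_const {p : ℂ} (hf : HasDbarAt f d (z - p)) :
    HasDbarAt (fun z => f (z - p)) d z := by
  obtain ⟨D, hD, rfl⟩ := hf
  refine ⟨_, hD.comp z ((hasFDerivAt_id z).sub_const p), ?_⟩
  simp

lemma HasDbarAt.comp_const_sub {q : ℂ} (hf : HasDbarAt f d (q - z)) :
    HasDbarAt (fun z => f (q - z)) (-d) z := by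
  obtain ⟨D, hD, rfl⟩ := hf
  refine ⟨_, hD.comp z ((hasFDerivAt_id z).const_sub q), ?_⟩
  simp
  ring

variable {τ : ℂ}

lemma hasDbarAt_Afun (τ z : ℂ) : HasDbarAt (Afun τ) (Yconst τ) z := by
  have h : HasDbarAt (starRingEnd ℂ : ℂ → ℂ) 1 z := by
    refine ⟨(Complex.conjCLE : ℂ →L[ℝ] ℂ), Complex.conjCLE.hasFDerivAt, ?_⟩
    simp
  change HasDbarAt (fun z => Yconst τ * ((starRingEnd ℂ) z - z)) _ _
  simpa [sub_eq_add_neg] using (h.add (hasDbarAt_of_differentiableAt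
    (f := fun z => -z) (by fun_prop))).const_mul (Yconst τ)

lemma hasDbarAt_Afun_pow (τ z : ℂ) (i : ℕ) :
    HasDbarAt (fun z => Afun τ z ^ (i + 1) / ((i + 1).factorial : ℂ))
      (Yconst τ * (Afun τ z ^ i / (i.factorial : ℂ))) z := by
  have h : ∀ i : ℕ, HasDbarAt (fun z => Afun τ z ^ (i + 1))
      ((i + 1) * (Yconst τ * Afun τ z ^ i)) z := by
    intro i
    induction i with
    | zero => simpa using hasDbarAt_Afun τ z
    | succ i ih =>
      have := ih.mul (hasDbarAt_Afun τ z)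
      simp_rw [pow_succ _ (i + 1)]
      convert this using 1
      push_cast
      ring
  have h2 := (h i).const_mul ((i + 1).factorial : ℂ)⁻¹
  simp only [div_eq_inv_mul]
  convert h2 using 1
  have h3 : ((i + 1 : ℕ) : ℂ) ≠ 0 := by exact_mod_cast i.succ_ne_zero
  have h4 : (i.factorial : ℂ) ≠ 0 := by exact_mod_cast i.factorial_ne_zero
  rw [Nat.factorial_succ]
  push_cast at h3 ⊢
  field_simp

lemma hasDbarAt_ehatNum_succ (hτ : 0 < τ.im) (m : ℕ) (z : ℂ) :
    HasDbarAt (ehatNum τ (m + 1)) (Yconst τ * ehatNum τ m z) z := by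
  have hN : ∀ j, HasDbarAt (numCoeff τ j) 0 z := fun j =>
    hasDbarAt_of_differentiableAt (differentiable_numCoeff hτ j z)
  have h : HasDbarAt (fun z => 1 * numCoeff τ (m + 1) z +
      ∑ p ∈ Finset.HasAntidiagonal.antidiagonal m,
        Afun τ z ^ (p.1 + 1) / ((p.1 + 1).factorial : ℂ) * numCoeff τ p.2 z)
      (1 * 0 + ∑ p ∈ Finset.HasAntidiagonal.antidiagonal m,
        (Yconst τ * (Afun τ z ^ p.1 / (p.1.factorial : ℂ)) * numCoeff τ p.2 z +
          Afun τ z ^ (p.1 + 1) / ((p.1 + 1).factorial : ℂ) * 0)) z :=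
    ((hN _).const_mul 1).add (HasDbarAt.sum fun p _ => (hasDbarAt_Afun_pow τ z p.1).mul (hN p.2))
  convert h using 1
  · funext w
    rw [ehatNum, Finset.Nat.sum_antidiagonal_succ]
    simp
  · simp only [mul_zero, zero_add, add_zero, ehatNum, Finset.mul_sum]
    exact Finset.sum_congr rfl fun p _ => by ring

/-- The antiholomorphic derivative lowers the index: `∂ê_{m+1} / ∂z̄ = Y ê_m`. -/
lemma hasDbarAt_ehat_succ (hτ : 0 < τ.im) (m : ℕ) {z : ℂ} (hz : z ∉ lattice τ) :
    HasDbarAt (ehat τ (m + 1)) (Yconst τ * ehat τ m z) z := by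
  have h1 : HasDbarAt (fun z => (theta τ z)⁻¹) 0 z :=
    hasDbarAt_of_differentiableAt ((differentiable_theta hτ z).inv (theta_ne_zero hτ hz))
  have h2 := (hasDbarAt_ehatNum_succ hτ m z).mul h1
  refine HasDbarAt.congr_of_eventuallyEq ?_ (f := fun z => ehatNum τ (m + 1) z * (theta τ z)⁻¹) ?_
  · convert h2 using 1
    rw [ehat_eq hτ m hz]
    ring
  · filter_upwards [(isClosed_lattice hτ).isOpen_compl.mem_nhds hz] with w hw
    rw [ehat_eq hτ _ hw, div_eq_mul_inv]

end Dbar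

/-! ### Simple holomorphic poles -/

section SimplePole

/-- Near `p`, the function `f` is of the form `h(z) / (z - p)` with `h` smooth and `h p = r`. The
number `r` is the holomorphic residue of `f dz` at `p`; it vanishes if `f` is smooth at `p`. -/
def HasSimplePole (f : ℂ → ℂ) (p r : ℂ) : Prop :=
  ∃ h : ℂ → ℂ, ContDiffAt ℝ ∞ h p ∧ (∀ᶠ z in 𝓝[≠] p, (z - p) * f z = h z) ∧ h p = r

variable {f g : ℂ → ℂ} {p r t : ℂ}

lemma hasSimplePole_of_contDiffAt (hf : ContDiffAt ℝ ∞ f p) : HasSimplePole f p 0 :=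
  ⟨fun z => (z - p) * f z, (contDiffAt_id.sub contDiffAt_const).mul hf,
    Filter.Eventually.of_forall fun _ => rfl, by simp⟩

lemma HasSimplePole.congr (hf : HasSimplePole f p r) (hfg : ∀ᶠ z in 𝓝[≠] p, g z = f z) :
    HasSimplePole g p r := by
  obtain ⟨h, hh, hfh, hr⟩ := hf
  refine ⟨h, hh, ?_, hr⟩
  filter_upwards [hfh, hfg] with z h1 h2
  rw [h2, h1]

lemma HasSimplePole.add (hf : HasSimplePole f p r) (hg : HasSimplePole g p t) :
    HasSimplePole (fun z => f z + g z) p (r + t) := by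
  obtain ⟨h, hh, hfh, rfl⟩ := hf
  obtain ⟨k, hk, hgk, rfl⟩ := hg
  refine ⟨fun z => h z + k z, hh.add hk, ?_, rfl⟩
  filter_upwards [hfh, hgk] with z h1 h2
  rw [mul_add, h1, h2]

lemma HasSimplePole.mul_contDiffAt (hf : HasSimplePole f p r) (hg : ContDiffAt ℝ ∞ g p) :
    HasSimplePole (fun z => f z * g z) p (r * g p) := by
  obtain ⟨h, hh, hfh, rfl⟩ := hf
  refine ⟨fun z => h z * g z, hh.mul hg, ?_, rfl⟩
  filter_upwards [hfh] with z h1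
  rw [← mul_assoc, h1]

lemma HasSimplePole.contDiffAt_mul (hg : HasSimplePole g p r) (hf : ContDiffAt ℝ ∞ f p) :
    HasSimplePole (fun z => f z * g z) p (f p * r) := by
  simpa only [mul_comm] using hg.mul_contDiffAt hf

lemma HasSimplePole.const_mul (a : ℂ) (hf : HasSimplePole f p r) :
    HasSimplePole (fun z => a * f z) p (a * r) :=
  hf.contDiffAt_mul contDiffAt_const

lemma HasSimplePole.sum {ι : Type*} {s : Finset ι} {f : ι → ℂ → ℂ} {r : ι → ℂ}
    (h : ∀ i ∈ s, HasSimplePole (f i) p (r i)) :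
    HasSimplePole (fun z => ∑ i ∈ s, f i z) p (∑ i ∈ s, r i) := by
  classical
  induction s using Finset.induction_on with
  | empty => simpa using hasSimplePole_of_contDiffAt (f := fun _ => 0) (p := p) contDiffAt_const
  | insert a s ha ih =>
    simp only [Finset.sum_insert ha]
    exact (h a (by simp)).add (ih fun i hi => h i (by simp [hi]))

lemma HasSimplePole.comp_sub_const {a : ℂ} (hf : HasSimplePole f (p - a) r) :
    HasSimplePole (fun z => f (z - a)) p r := by
  obtain ⟨h, hh, hfh, rfl⟩ := hf
  have ht : Filter.Tendsto (fun z : ℂ => z - a) (𝓝[≠] p) (𝓝[≠] (p - a)) := by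
    refine tendsto_nhdsWithin_iff.mpr ⟨?_, ?_⟩
    · exact ((continuous_id.sub continuous_const).tendsto p).mono_left nhdsWithin_le_nhds
    · filter_upwards [self_mem_nhdsWithin] with z hz
      simpa using hz
  refine ⟨fun z => h (z - a), ?_, ?_, rfl⟩
  · exact ContDiffAt.comp (g := h) p hh (contDiffAt_id.sub contDiffAt_const)
  · filter_upwards [ht.eventually hfh] with z hz
    rw [← hz]
    ring

lemma HasSimplePole.comp_const_sub {a : ℂ} (hf : HasSimplePole f (a - p) r) :
    HasSimplePole (fun z => f (a - z)) p (-r) := by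
  obtain ⟨h, hh, hfh, rfl⟩ := hf
  have ht : Filter.Tendsto (fun z : ℂ => a - z) (𝓝[≠] p) (𝓝[≠] (a - p)) := by
    refine tendsto_nhdsWithin_iff.mpr ⟨?_, ?_⟩
    · exact ((continuous_const.sub continuous_id).tendsto p).mono_left nhdsWithin_le_nhds
    · filter_upwards [self_mem_nhdsWithin] with z hz
      simpa using hz
  refine ⟨fun z => -h (a - z), ?_, ?_, rfl⟩
  · exact (ContDiffAt.comp (g := h) p hh (contDiffAt_const.sub contDiffAt_id)).neg
  · filter_upwards [ht.eventually hfh] with z hz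
    rw [← hz]
    ring

lemma HasSimplePole.hasHolPoleAt (hf : HasSimplePole f p r) : HasHolPoleAt f p 1 := by
  obtain ⟨h, hh, hfh, -⟩ := hf
  exact ⟨h, hh, by simpa using hfh⟩

lemma HasSimplePole.hasResAt (hf : HasSimplePole f p r) : HasResAt f p r := by
  obtain ⟨h, hh, hfh, rfl⟩ := hf
  rw [HasResAt, Metric.tendsto_nhds]
  intro δ hδ
  have h1 : ∀ᶠ z in 𝓝 p, ‖h z - h p‖ < δ / 2 := by
    have := Metric.tendsto_nhds.mp hh.continuousAt (δ / 2) (by positivity)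
    simpa only [dist_eq_norm] using this
  have hcont : ∀ᶠ z in 𝓝 p, ContinuousAt h z := by
    obtain ⟨u, hu, hhu⟩ := hh.contDiffOn (m := 1) (by exact_mod_cast le_top) (by simp)
    filter_upwards [eventually_mem_nhds_iff.mpr hu] with z hz
    exact hhu.continuousOn.continuousAt hz
  have hall := (eventually_nhdsWithin_iff.mp hfh).and (h1.and hcont)
  obtain ⟨ρ, hρ, hball⟩ := Metric.eventually_nhds_iff.mp hall
  filter_upwards [Ioo_mem_nhdsGT hρ] with ε hε
  have hsph : ∀ z ∈ Metric.sphere p ε, z - p ≠ 0 ∧ (z - p) * f z = h z ∧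
      ‖h z - h p‖ < δ / 2 ∧ ContinuousAt h z := by
    intro z hz
    have hd : dist z p < ρ := by rw [Metric.mem_sphere.mp hz]; exact hε.2
    have hzp : z ≠ p := by
      rintro rfl
      rw [Metric.mem_sphere, dist_self] at hz
      exact hε.1.ne hz
    obtain ⟨ha, hb, hc⟩ := hball hd
    exact ⟨sub_ne_zero.mpr hzp, ha hzp, hb, hc⟩
  have hint : (∮ z in C(p, ε), f z) =
      (∮ z in C(p, ε), (z - p)⁻¹ * (h z - h p)) + h p * (2 * Real.pi * Complex.I) := by
    rw [← circleIntegral.integral_sub_center_inv p hε.1.ne', ← circleIntegral.integral_const_mul,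
      ← circleIntegral.integral_add]
    · refine circleIntegral.integral_congr hε.1.le fun z hz => ?_
      obtain ⟨h0, h2, -⟩ := hsph z hz
      rw [← h2]
      field_simp
      ring
    · refine ContinuousOn.circleIntegrable hε.1.le fun z hz => ContinuousAt.continuousWithinAt ?_
      obtain ⟨h0, -, -, h3⟩ := hsph z hz
      have : ContinuousAt (fun z => (z - p)⁻¹) z := by fun_prop (disch := assumption)
      fun_prop
    · refine ContinuousOn.circleIntegrable hε.1.le fun z hz => ContinuousAt.continuousWithinAt ?_
      obtain ⟨h0, -⟩ := hsph z hz
      fun_prop (disch := assumption)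
  have hbound : ‖∮ z in C(p, ε), (z - p)⁻¹ * (h z - h p)‖ ≤ 2 * Real.pi * ε * (ε⁻¹ * (δ / 2)) := by
    refine circleIntegral.norm_integral_le_of_norm_le_const hε.1.le fun z hz => ?_
    obtain ⟨-, -, h3, -⟩ := hsph z hz
    rw [norm_mul, norm_inv, ← dist_eq_norm z p, Metric.mem_sphere.mp hz]
    have := inv_nonneg.mpr hε.1.le
    gcongr
  have hpi : (2 * Real.pi * Complex.I : ℂ) ≠ 0 := by simp [Real.pi_ne_zero, Complex.I_ne_zero]
  have heq : (2 * Real.pi * Complex.I : ℂ)⁻¹ * (∮ z in C(p, ε), f z) - h p =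
      (2 * Real.pi * Complex.I : ℂ)⁻¹ * ∮ z in C(p, ε), (z - p)⁻¹ * (h z - h p) := by
    rw [hint]
    field_simp
    ring
  rw [dist_eq_norm, heq, norm_mul, norm_inv]
  have hn : ‖(2 * Real.pi * Complex.I : ℂ)‖ = 2 * Real.pi := by
    simp [abs_of_pos Real.pi_pos]
  rw [hn, inv_mul_lt_iff₀ (by positivity)]
  refine hbound.trans_lt ?_
  have : ε ≠ 0 := hε.1.ne'
  have h5 : 2 * Real.pi * ε * (ε⁻¹ * (δ / 2)) = Real.pi * δ := by field_simp
  rw [h5]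
  nlinarith [mul_pos Real.pi_pos hδ]

/-- Near a simple pole, `f` is bounded by a multiple of `1 / |z - p|`. -/
lemma HasSimplePole.exists_norm_le (hf : HasSimplePole f p r) :
    ∃ C : ℝ, ∀ᶠ z in 𝓝[≠] p, ‖f z‖ ≤ C * ‖z - p‖⁻¹ := by
  obtain ⟨h, hh, hfh, -⟩ := hf
  refine ⟨‖h p‖ + 1, ?_⟩
  have h1 : ∀ᶠ z in 𝓝 p, ‖h z‖ < ‖h p‖ + 1 :=
    hh.continuousAt.norm.eventually_lt_const (lt_add_one _)
  filter_upwards [hfh, nhdsWithin_le_nhds h1, self_mem_nhdsWithin] with z hz hz1 hzp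
  have hpos : 0 < ‖z - p‖ := norm_pos_iff.mpr (sub_ne_zero.mpr hzp)
  rw [← div_eq_mul_inv, le_div_iff₀ hpos, mul_comm, ← norm_mul, hz]
  exact hz1.le

/-- Near a simple pole of residue zero, the derivative of `f` is bounded by a multiple of
`1 / |z - p|` only, hence is locally integrable. -/
lemma HasSimplePole.exists_norm_fderiv_le (hf : HasSimplePole f p 0) (v : ℂ) :
    ∃ C : ℝ, ∀ᶠ z in 𝓝[≠] p, ‖fderiv ℝ f z v‖ ≤ C * ‖z - p‖⁻¹ := by
  obtain ⟨h, hh, hfh, h0⟩ := hf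
  obtain ⟨K, t, ht, hK⟩ := (hh.of_le (m := 1) (by exact_mod_cast le_top)).exists_lipschitzOnWith
  have hdiff : ∀ᶠ z in 𝓝 p, DifferentiableAt ℝ h z := by
    obtain ⟨u, hu, hhu⟩ := hh.contDiffOn (m := 1) (by exact_mod_cast le_top) (by simp)
    filter_upwards [eventually_mem_nhds_iff.mpr hu] with z hz
    exact (hhu.differentiableOn one_ne_zero).differentiableAt hz
  refine ⟨K * ‖v‖ + K * ‖v‖, ?_⟩
  have hev := (eventually_nhdsWithin_eventually_nhds_iff_of_isOpen
    (isOpen_compl_singleton (x := p))).mpr hfh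
  filter_upwards [hev, nhdsWithin_le_nhds hdiff,
    nhdsWithin_le_nhds (eventually_mem_nhds_iff.mpr ht), self_mem_nhdsWithin] with z hz hd hzt hzp
  have hne : z - p ≠ 0 := sub_ne_zero.mpr hzp
  have hpos : 0 < ‖z - p‖ := norm_pos_iff.mpr hne
  have heq : f =ᶠ[𝓝 z] fun w => (w - p)⁻¹ * h w := by
    have hne' : ∀ᶠ w in 𝓝 z, w ≠ p := eventually_ne_nhds hzp
    filter_upwards [hz, hne'] with w hw hwp
    rw [← hw, inv_mul_cancel_left₀ (sub_ne_zero.mpr hwp)]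
  have hinv : HasFDerivAt (fun w : ℂ => (w - p)⁻¹)
      ((ContinuousLinearMap.toSpanSingleton ℂ (-((z - p) ^ 2)⁻¹)).restrictScalars ℝ) z := by
    have h1 : HasDerivAt (fun w : ℂ => w - p) 1 z := (hasDerivAt_id z).sub_const p
    have h2 := h1.inv hne
    rw [neg_div, one_div] at h2
    exact h2.hasFDerivAt.restrictScalars ℝ
  have hD := (hinv.mul hd.hasFDerivAt).congr_of_eventuallyEq heq
  rw [hD.fderiv]
  simp only [_root_.add_apply, _root_.smul_apply, smul_eq_mul,
    ContinuousLinearMap.coe_restrictScalars', ContinuousLinearMap.toSpanSingleton_apply]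
  have hhz : ‖h z‖ ≤ K * ‖z - p‖ := by
    have := hK.dist_le_mul z (mem_of_mem_nhds hzt) p (mem_of_mem_nhds ht)
    rwa [h0, dist_zero_right, dist_eq_norm] at this
  have hDh : ‖fderiv ℝ h z v‖ ≤ K * ‖v‖ :=
    (ContinuousLinearMap.le_opNorm _ _).trans
      (mul_le_mul_of_nonneg_right (norm_fderiv_le_of_lipschitzOn ℝ hzt hK) (norm_nonneg _))
  refine (norm_add_le _ _).trans ?_
  rw [add_mul]
  refine add_le_add ?_ ?_
  · rw [norm_mul, norm_inv, mul_comm]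
    gcongr
  · rw [norm_mul, norm_mul, norm_neg, norm_inv, norm_pow]
    calc ‖h z‖ * (‖v‖ * (‖z - p‖ ^ 2)⁻¹) ≤ K * ‖z - p‖ * (‖v‖ * (‖z - p‖ ^ 2)⁻¹) := by gcongr
      _ = K * ‖v‖ * ‖z - p‖⁻¹ := by field_simp

end SimplePole

/-! ### Functions on the elliptic curve with simple poles -/

section PoleSet

variable {τ : ℂ} {S : Finset ℂ}

lemma add_mem_poleSet_iff {z l : ℂ} (hl : l ∈ lattice τ) :
    z + l ∈ poleSet τ S ↔ z ∈ poleSet τ S := by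
  simp only [poleSet, Set.mem_ofPred_eq, add_sub_right_comm z l, add_mem_lattice_iff hl]

lemma poleSet_eq_biUnion (τ : ℂ) (S : Finset ℂ) :
    poleSet τ S = ⋃ p ∈ S, (fun z => z - p) ⁻¹' lattice τ := by
  ext z
  simp [poleSet]

lemma isClosed_poleSet (hτ : 0 < τ.im) (S : Finset ℂ) : IsClosed (poleSet τ S) := by
  rw [poleSet_eq_biUnion]
  exact S.finite_toSet.isClosed_biUnion fun p _ =>
    (isClosed_lattice hτ).preimage (continuous_id.sub continuous_const)

lemma countable_poleSet (τ : ℂ) (S : Finset ℂ) : (poleSet τ S).Countable := by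
  rw [poleSet_eq_biUnion]
  exact S.countable_toSet.biUnion fun p _ =>
    (countable_lattice τ).preimage (sub_left_injective)

lemma eventually_notMem_poleSet (hτ : 0 < τ.im) (S : Finset ℂ) (z₀ : ℂ) :
    ∀ᶠ z in 𝓝[≠] z₀, z ∉ poleSet τ S := by
  have h : ∀ᶠ z in 𝓝[≠] z₀, ∀ p ∈ S, z - p ∉ lattice τ := by
    rw [Filter.eventually_all_finset]
    intro p _
    have ht : Filter.Tendsto (fun z : ℂ => z - p) (𝓝[≠] z₀) (𝓝[≠] (z₀ - p)) := by
      refine tendsto_nhdsWithin_iff.mpr ⟨?_, ?_⟩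
      · exact ((continuous_id.sub continuous_const).tendsto z₀).mono_left nhdsWithin_le_nhds
      · filter_upwards [self_mem_nhdsWithin] with z hz
        simpa using hz
    exact ht.eventually (eventually_notMem_lattice hτ)
  filter_upwards [h] with z hz
  rintro ⟨p, hp, hm⟩
  exact hz p hp hm

/-- Smooth functions on `E` with at most simple holomorphic poles at the points of `S`, with
prescribed residues. -/
structure IsSimplePolar (τ : ℂ) (S : Finset ℂ) (f : ℂ → ℂ) (r : ℂ → ℂ) : Prop where
  periodic : ∀ z ∉ poleSet τ S, ∀ l ∈ lattice τ, f (z + l) = f z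
  smooth : ∀ z ∉ poleSet τ S, ContDiffAt ℝ ∞ f z
  pole : ∀ p ∈ S, HasSimplePole f p (r p)

variable {f g : ℂ → ℂ} {r t : ℂ → ℂ}

lemma IsSimplePolar.memPolar (hf : IsSimplePolar τ S f r) : MemPolar τ S f :=
  ⟨hf.periodic, fun z hz => (hf.smooth z hz).contDiffWithinAt,
    fun p hp => ⟨1, (hf.pole p hp).hasHolPoleAt⟩⟩

lemma IsSimplePolar.memLog (hf : IsSimplePolar τ S f r) : MemLog τ S f :=
  ⟨hf.memPolar, fun p hp => (hf.pole p hp).hasHolPoleAt⟩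

lemma IsSimplePolar.hasRes (hf : IsSimplePolar τ S f r)
    (hS : ∀ p ∈ S, ∀ q ∈ S, p - q ∈ lattice τ → p = q) : HasRes τ f (∑ p ∈ S, r p) :=
  ⟨S, r, hS, hf.memPolar, fun p hp => (hf.pole p hp).hasResAt, rfl⟩

lemma IsSimplePolar.add (hf : IsSimplePolar τ S f r) (hg : IsSimplePolar τ S g t) :
    IsSimplePolar τ S (fun z => f z + g z) (fun p => r p + t p) :=
  ⟨fun z hz l hl => by rw [hf.periodic z hz l hl, hg.periodic z hz l hl],
    fun z hz => (hf.smooth z hz).add (hg.smooth z hz),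
    fun p hp => (hf.pole p hp).add (hg.pole p hp)⟩

lemma IsSimplePolar.const_mul (a : ℂ) (hf : IsSimplePolar τ S f r) :
    IsSimplePolar τ S (fun z => a * f z) (fun p => a * r p) :=
  ⟨fun z hz l hl => by rw [hf.periodic z hz l hl],
    fun z hz => contDiffAt_const.mul (hf.smooth z hz),
    fun p hp => (hf.pole p hp).const_mul a⟩

lemma IsSimplePolar.sum {ι : Type*} {s : Finset ι} {f : ι → ℂ → ℂ} {r : ι → ℂ → ℂ}
    (h : ∀ i ∈ s, IsSimplePolar τ S (f i) (r i)) :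
    IsSimplePolar τ S (fun z => ∑ i ∈ s, f i z) (fun p => ∑ i ∈ s, r i p) :=
  ⟨fun z hz l hl => Finset.sum_congr rfl fun i hi => (h i hi).periodic z hz l hl,
    fun z hz => ContDiffAt.sum fun i hi => (h i hi).smooth z hz,
    fun p hp => HasSimplePole.sum fun i hi => (h i hi).pole p hp⟩

/-- At every point of `ℂ`, translates of poles included, there is at most a simple pole. -/
lemma IsSimplePolar.exists_hasSimplePole (hτ : 0 < τ.im) (hf : IsSimplePolar τ S f r) (z₀ : ℂ) :
    HasSimplePole f z₀ 0 ∨ ∃ p ∈ S, HasSimplePole f z₀ (r p) := by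
  by_cases hz : z₀ ∈ poleSet τ S
  · right
    obtain ⟨p, hp, hl⟩ := hz
    refine ⟨p, hp, ?_⟩
    have h1 : HasSimplePole f (z₀ - (z₀ - p)) (r p) := by simpa using hf.pole p hp
    refine h1.comp_sub_const.congr ?_
    filter_upwards [eventually_notMem_poleSet hτ S z₀] with z hz
    have h2 : z - (z₀ - p) ∉ poleSet τ S := by
      rw [sub_eq_add_neg]
      exact fun h => hz ((add_mem_poleSet_iff (neg_mem_lattice hl)).mp h)
    rw [← hf.periodic _ h2 _ hl, sub_add_cancel]
  · exact Or.inl (hasSimplePole_of_contDiffAt (hf.smooth z₀ hz))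

end PoleSet

/-! ### Poles of the Eisenstein–Kronecker functions -/

section EhatPole

variable {τ : ℂ}

/-- Only `ê_1` has a nonzero residue at the origin. -/
lemma hasSimplePole_ehat (hτ : 0 < τ.im) (m : ℕ) : HasSimplePole (ehat τ m) 0 (kdelta m 1) := by
  refine ⟨fun z => ehatNum τ m z * thetaInv τ z, ?_, ?_, ?_⟩
  · exact (contDiff_ehatNum hτ m).contDiffAt.mul
      ((analyticAt_thetaInv hτ).contDiffAt.restrict_scalars ℝ)
  · filter_upwards [eventually_notMem_lattice hτ (p := 0), self_mem_nhdsWithin] with z hz hz0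
    have hz0' : z ≠ 0 := hz0
    rw [ehat_eq hτ m hz, thetaInv, ← mul_dslope_theta z, sub_zero]
    field_simp
  · change ehatNum τ m 0 * thetaInv τ 0 = _
    rw [ehatNum_apply_zero hτ, thetaInv, dslope_theta_zero hτ, inv_one, mul_one]

lemma contDiffAt_ehat_sub (hτ : 0 < τ.im) (m : ℕ) {p z : ℂ} (hz : z - p ∉ lattice τ) :
    ContDiffAt ℝ ∞ (fun z => ehat τ m (z - p)) z :=
  ContDiffAt.comp (g := ehat τ m) z (contDiffAt_ehat hτ m hz) (contDiffAt_id.sub contDiffAt_const)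

lemma contDiffAt_ehat_sub' (hτ : 0 < τ.im) (m : ℕ) {q z : ℂ} (hz : q - z ∉ lattice τ) :
    ContDiffAt ℝ ∞ (fun z => ehat τ m (q - z)) z :=
  ContDiffAt.comp (g := ehat τ m) z (contDiffAt_ehat hτ m hz) (contDiffAt_const.sub contDiffAt_id)

lemma hasSimplePole_ehat_sub (hτ : 0 < τ.im) (m : ℕ) (p : ℂ) :
    HasSimplePole (fun z => ehat τ m (z - p)) p (kdelta m 1) :=
  HasSimplePole.comp_sub_const (by simpa using hasSimplePole_ehat hτ m)

lemma hasSimplePole_ehat_sub' (hτ : 0 < τ.im) (m : ℕ) (q : ℂ) :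
    HasSimplePole (fun z => ehat τ m (q - z)) q (-kdelta m 1) :=
  HasSimplePole.comp_const_sub (by simpa using hasSimplePole_ehat hτ m)

lemma isSimplePolar_ehat_sub (hτ : 0 < τ.im) (m : ℕ) (p : ℂ) :
    IsSimplePolar τ {p} (fun z => ehat τ m (z - p)) (fun _ => kdelta m 1) where
  periodic z _ l hl := by rw [add_sub_right_comm, ehat_add_of_mem hτ m _ hl]
  smooth z hz := contDiffAt_ehat_sub hτ m fun h => hz ⟨p, by simp, h⟩
  pole x hx := by
    rw [Finset.mem_singleton] at hx
    subst hx
    exact hasSimplePole_ehat_sub hτ m x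

/-- A product of two functions `ê_k`, `ê_l` with disjoint polar divisors. -/
lemma isSimplePolar_ehat_mul_ehat (hτ : 0 < τ.im) (k l : ℕ) {p q : ℂ}
    (hpq : q - p ∉ lattice τ) :
    IsSimplePolar τ {p, q} (fun z => ehat τ k (z - p) * ehat τ l (q - z))
      (fun x => if x = p then kdelta k 1 * ehat τ l (q - p)
        else -(ehat τ k (q - p) * kdelta l 1)) where
  periodic z _ x hx := by
    rw [add_sub_right_comm, ehat_add_of_mem hτ k _ hx, ← sub_sub, sub_eq_add_neg (q - z),
      ehat_add_of_mem hτ l _ (neg_mem_lattice hx)]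
  smooth z hz := by
    have h1 : z - p ∉ lattice τ := fun h => hz ⟨p, by simp, h⟩
    have h2 : q - z ∉ lattice τ := fun h => hz ⟨q, by simp, by simpa using neg_mem_lattice h⟩
    exact (contDiffAt_ehat_sub hτ k h1).mul (contDiffAt_ehat_sub' hτ l h2)
  pole x hx := by
    by_cases hxp : x = p
    · subst hxp
      simpa using (hasSimplePole_ehat_sub hτ k x).mul_contDiffAt (contDiffAt_ehat_sub' hτ l hpq)
    · have hxq : x = q := by simpa [hxp] using hx
      subst hxq
      simpa [hxp] using
        (hasSimplePole_ehat_sub' hτ l x).contDiffAt_mul (contDiffAt_ehat_sub hτ k hpq)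

end EhatPole

open MeasureTheory

/-! ### Integration over the period parallelogram -/

section FundDomain

/-- The real linear map `x + i y ↦ x + y τ`. -/
def coordMap (τ : ℂ) : ℂ →L[ℝ] ℂ :=
  Complex.reCLM.smulRight (1 : ℂ) + Complex.imCLM.smulRight τ

variable {τ : ℂ}

lemma coordMap_apply (τ z : ℂ) : coordMap τ z = z.re + z.im * τ := by
  simp [coordMap]

lemma det_coordMap (τ : ℂ) : (coordMap τ).det = τ.im := by
  rw [ContinuousLinearMap.det, ← LinearMap.det_toMatrix Complex.basisOneI, Matrix.det_fin_two]
  simp [LinearMap.toMatrix_apply, coordMap_apply]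

lemma injective_coordMap (hτ : 0 < τ.im) : Function.Injective (coordMap τ) := by
  refine (injective_iff_map_eq_zero (coordMap τ)).mpr fun z hz => ?_
  rw [coordMap_apply] at hz
  have him := congrArg Complex.im hz
  have hre := congrArg Complex.re hz
  simp at him hre
  have h1 : z.im = 0 := him.resolve_right hτ.ne'
  apply Complex.ext
  · simpa [h1] using hre
  · exact h1

/-- The unit square, in real coordinates with respect to the periods. -/
def unitSquare : Set (ℝ × ℝ) := Set.Ico (0 : ℝ) 1 ×ˢ Set.Ico (0 : ℝ) 1

lemma fundDomain_eq_image (τ : ℂ) :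
    fundDomain τ = coordMap τ '' (Complex.measurableEquivRealProd ⁻¹' unitSquare) := by
  ext z
  constructor
  · rintro ⟨p, hp, rfl⟩
    refine ⟨Complex.measurableEquivRealProd.symm p, ?_, ?_⟩
    · simpa [unitSquare] using hp
    · simp [coordMap_apply]
  · rintro ⟨w, hw, rfl⟩
    exact ⟨Complex.measurableEquivRealProd w, hw, by simp [coordMap_apply]⟩

lemma measurableSet_preimage_unitSquare :
    MeasurableSet (Complex.measurableEquivRealProd ⁻¹' unitSquare) :=
  Complex.measurableEquivRealProd.measurable (measurableSet_Ico.prod measurableSet_Ico)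

lemma integral_fundDomain (hτ : 0 < τ.im) (g : ℂ → ℂ) :
    ∫ z in fundDomain τ, g z = τ.im * ∫ p in unitSquare, g (p.1 + p.2 * τ) := by
  rw [fundDomain_eq_image, integral_image_eq_integral_abs_det_fderiv_smul volume
    measurableSet_preimage_unitSquare (fun z _ => (coordMap τ).hasFDerivWithinAt)
    (injective_coordMap hτ).injOn]
  simp only [det_coordMap, abs_of_pos hτ]
  rw [integral_smul, ← Complex.volume_preserving_equiv_real_prod.setIntegral_preimage_emb
    Complex.measurableEquivRealProd.measurableEmbedding]
  simp [coordMap_apply]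

lemma integrableOn_unitSquare (hτ : 0 < τ.im) {g : ℂ → ℂ} (hg : IntegrableOn g (fundDomain τ)) :
    IntegrableOn (fun p : ℝ × ℝ => g (p.1 + p.2 * τ)) unitSquare := by
  rw [fundDomain_eq_image, integrableOn_image_iff_integrableOn_abs_det_fderiv_smul volume
    measurableSet_preimage_unitSquare (fun z _ => (coordMap τ).hasFDerivWithinAt)
    (injective_coordMap hτ).injOn] at hg
  rw [← Complex.volume_preserving_equiv_real_prod.integrableOn_comp_preimage
    Complex.measurableEquivRealProd.measurableEmbedding]
  have := hg.smul (τ.im)⁻¹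
  refine this.congr (Filter.Eventually.of_forall fun z => ?_)
  simp [det_coordMap, abs_of_pos hτ, hτ.ne', coordMap_apply]

lemma fundDomain_subset_compact (τ : ℂ) : ∃ K, IsCompact K ∧ fundDomain τ ⊆ K :=
  ⟨(fun x : ℝ × ℝ => (x.1 : ℂ) + x.2 * τ) '' (Set.Icc (0 : ℝ) 1 ×ˢ Set.Icc (0 : ℝ) 1),
    (isCompact_Icc.prod isCompact_Icc).image (by fun_prop),
    Set.image_mono (Set.prod_mono Set.Ico_subset_Icc_self Set.Ico_subset_Icc_self)⟩

lemma integrableOn_fundDomain_const (a : ℂ) : IntegrableOn (fun _ => a) (fundDomain τ) := by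
  obtain ⟨K, hK, hsub⟩ := fundDomain_subset_compact τ
  exact (continuousOn_const.integrableOn_compact hK).mono_set hsub

lemma integral_fundDomain_const (hτ : 0 < τ.im) (a : ℂ) :
    ∫ _ in fundDomain τ, a = τ.im * a := by
  rw [integral_fundDomain hτ, setIntegral_const, unitSquare, measureReal_def,
    Measure.volume_eq_prod, Measure.prod_prod]
  simp

/-- A function whose singularities are `O(1 / |z - z₀|)` is locally integrable on `ℂ`. -/
lemma locallyIntegrable_of_norm_le_inv {g : ℂ → ℂ} (hm : AEStronglyMeasurable g volume)
    (hb : ∀ z₀, ∃ C : ℝ, ∀ᶠ z in 𝓝[≠] z₀, ‖g z‖ ≤ C * ‖z - z₀‖⁻¹) : LocallyIntegrable g := by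
  intro z₀
  obtain ⟨C, hC⟩ := hb z₀
  obtain ⟨ρ, hρ, hball⟩ := Metric.eventually_nhds_iff.mp (eventually_nhdsWithin_iff.mp hC)
  refine ⟨Metric.ball z₀ ρ, Metric.ball_mem_nhds z₀ hρ, ?_⟩
  have hmp : MeasurePreserving (fun z : ℂ => z + z₀) volume volume :=
    measurePreserving_add_right volume z₀
  rw [← hmp.integrableOn_comp_preimage (measurableEmbedding_addRight z₀)]
  have hpre : (fun z : ℂ => z + z₀) ⁻¹' Metric.ball z₀ ρ = Metric.ball 0 ρ := by
    ext z
    simp [dist_eq_norm]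
  rw [hpre]
  refine integrableOn_ball_of_norm_le_rpow (C := C) (α := 1) (by simp) (by simp) ?_
    (hm.comp_measurePreserving hmp)
  rw [ae_restrict_iff' measurableSet_ball]
  filter_upwards [(Set.countable_singleton (0 : ℂ)).ae_notMem volume] with z hz hzb
  have := hball (y := z + z₀) (by simpa [dist_eq_norm] using hzb) (by simpa using hz)
  simpa [Real.rpow_neg_one] using this

end FundDomain

/-! ### Stokes' theorem and regularized integrals -/

section Stokes

variable {τ : ℂ} {S : Finset ℂ} {f : ℂ → ℂ} {r : ℂ → ℂ}

lemma IsSimplePolar.integrableOn_fundDomain (hτ : 0 < τ.im) (hf : IsSimplePolar τ S f r) :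
    IntegrableOn f (fundDomain τ) := by
  obtain ⟨K, hK, hsub⟩ := fundDomain_subset_compact τ
  refine ((locallyIntegrable_of_norm_le_inv ?_
    fun z₀ => ?_).integrableOn_isCompact hK).mono_set hsub
  · have hc : ContinuousOn f (poleSet τ S)ᶜ := fun z hz =>
      (hf.smooth z hz).continuousAt.continuousWithinAt
    have h := hc.aestronglyMeasurable (μ := volume) (isClosed_poleSet hτ S).measurableSet.compl
    rwa [Measure.restrict_eq_self_of_ae_mem] at h
    filter_upwards [(countable_poleSet τ S).ae_notMem volume] with z hz using hz
  · rcases hf.exists_hasSimplePole hτ z₀ with h | ⟨p, -, h⟩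
    · exact h.exists_norm_le
    · exact h.exists_norm_le

lemma IsSimplePolar.integrableOn_fderiv (hτ : 0 < τ.im) (hf : IsSimplePolar τ S f fun _ => 0)
    (v : ℂ) : IntegrableOn (fun z => fderiv ℝ f z v) (fundDomain τ) := by
  obtain ⟨K, hK, hsub⟩ := fundDomain_subset_compact τ
  refine ((locallyIntegrable_of_norm_le_inv ?_
    fun z₀ => ?_).integrableOn_isCompact hK).mono_set hsub
  · exact (measurable_fderiv_apply_const ℝ f v).aestronglyMeasurable
  · rcases hf.exists_hasSimplePole hτ z₀ with h | ⟨p, -, h⟩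
    · exact h.exists_norm_fderiv_le v
    · exact h.exists_norm_fderiv_le v

/-- The fundamental theorem of calculus over a closed line on `E` that avoids the poles. -/
lemma IsSimplePolar.integral_fderiv_line (hf : IsSimplePolar τ S f r) {v w : ℂ}
    (hv : v ∈ lattice τ) (hw : ∀ t : ℝ, w + t * v ∉ poleSet τ S) :
    ∫ t in (0 : ℝ)..1, fderiv ℝ f (w + t * v) v = 0 := by
  have hline : ∀ t : ℝ, HasDerivAt (fun t : ℝ => w + t * v) v t := fun t => by
    simpa using ((Complex.ofRealCLM.hasDerivAt (x := t)).mul_const v).const_add w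
  have hder : ∀ t : ℝ, HasDerivAt (fun t : ℝ => f (w + t * v)) (fderiv ℝ f (w + t * v) v) t :=
    fun t => (((hf.smooth _ (hw t)).differentiableAt (by simp)).hasFDerivAt).comp_hasDerivAt t
      (hline t)
  have hcont : Continuous fun t : ℝ => fderiv ℝ f (w + t * v) v := by
    refine continuous_iff_continuousAt.mpr fun t => ?_
    have h1 : ContinuousAt (fderiv ℝ f) (w + t * v) :=
      ((hf.smooth _ (hw t)).fderiv_right (m := 0) (by simp)).continuousAt
    have h2 : ContinuousAt (fun t : ℝ => fderiv ℝ f (w + t * v)) t :=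
      ContinuousAt.comp (f := fun t : ℝ => w + t * v) h1 (hline t).continuousAt
    exact h2.clm_apply continuousAt_const
  rw [intervalIntegral.integral_eq_sub_of_hasDerivAt (fun t _ => hder t)
    (hcont.intervalIntegrable _ _)]
  have h0 := hw 0
  simp only [Complex.ofReal_zero, zero_mul, add_zero] at h0
  simp [hf.periodic w h0 v hv]

lemma integral_Ico_zero_one_eq (g : ℝ → ℂ) :
    ∫ t in Set.Ico (0 : ℝ) 1, g t = ∫ t in (0 : ℝ)..1, g t := by
  rw [intervalIntegral.integral_of_le zero_le_one, integral_Ico_eq_integral_Ioc]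

/-- Stokes' theorem on `E`: without residues, the derivative along the period `1` has mean zero.
By Fubini's theorem, the integral is computed on the lines that avoid the poles. -/
lemma IsSimplePolar.integral_fderiv_one (hτ : 0 < τ.im) (hf : IsSimplePolar τ S f fun _ => 0) :
    ∫ z in fundDomain τ, fderiv ℝ f z 1 = 0 := by
  have hint := integrableOn_unitSquare hτ (hf.integrableOn_fderiv hτ 1)
  rw [unitSquare, IntegrableOn, Measure.volume_eq_prod, ← Measure.prod_restrict] at hint
  rw [integral_fundDomain hτ, unitSquare, Measure.volume_eq_prod, ← Measure.prod_restrict,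
    integral_prod_symm _ hint]
  refine mul_eq_zero_of_right _ (integral_eq_zero_of_ae (ae_restrict_of_ae ?_))
  have hcount : ((fun z : ℂ => z.im / τ.im) '' poleSet τ S).Countable :=
    (countable_poleSet τ S).image _
  filter_upwards [hcount.ae_notMem volume] with y hy
  rw [integral_Ico_zero_one_eq]
  have := hf.integral_fderiv_line (v := 1) (w := y * τ) one_mem_lattice fun t ht =>
    hy ⟨_, ht, by simp [hτ.ne']⟩
  simpa [add_comm] using this

lemma IsSimplePolar.integral_fderiv_tau (hτ : 0 < τ.im) (hf : IsSimplePolar τ S f fun _ => 0) :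
    ∫ z in fundDomain τ, fderiv ℝ f z τ = 0 := by
  have hint := integrableOn_unitSquare hτ (hf.integrableOn_fderiv hτ τ)
  rw [unitSquare, IntegrableOn, Measure.volume_eq_prod, ← Measure.prod_restrict] at hint
  rw [integral_fundDomain hτ, unitSquare, Measure.volume_eq_prod, ← Measure.prod_restrict,
    integral_prod _ hint]
  refine mul_eq_zero_of_right _ (integral_eq_zero_of_ae (ae_restrict_of_ae ?_))
  have hcount : ((fun z : ℂ => z.re - z.im / τ.im * τ.re) '' poleSet τ S).Countable :=
    (countable_poleSet τ S).image _
  filter_upwards [hcount.ae_notMem volume] with x hx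
  rw [integral_Ico_zero_one_eq]
  exact hf.integral_fderiv_line (v := τ) (w := x) tau_mem_lattice fun t ht =>
    hx ⟨_, ht, by simp [hτ.ne']⟩

/-- Stokes' theorem: if `∂P / ∂z̄ = g` off the poles and `P` has no residues, then `g` has mean
zero. -/
lemma IsSimplePolar.integral_dbar_eq_zero (hτ : 0 < τ.im) (hf : IsSimplePolar τ S f fun _ => 0)
    {g : ℂ → ℂ} (hg : ∀ z ∉ poleSet τ S, HasDbarAt f (g z) z) :
    ∫ z in fundDomain τ, g z = 0 := by
  have h1 := hf.integrableOn_fderiv hτ 1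
  have h2 := hf.integrableOn_fderiv hτ τ
  have hτ0 : (τ.im : ℂ) ≠ 0 := by exact_mod_cast hτ.ne'
  have hae : ∀ᵐ z ∂(volume.restrict (fundDomain τ)), g z =
      (1 - Complex.I * τ.re / τ.im) / 2 * fderiv ℝ f z 1 +
        Complex.I / (2 * τ.im) * fderiv ℝ f z τ := by
    -- The directions `1` and `i` of the Wirtinger derivative are expressed by the periods `1`, `τ`.
    refine ae_restrict_of_ae ?_
    filter_upwards [(countable_poleSet τ S).ae_notMem volume] with z hz
    obtain ⟨D, hD, hd⟩ := hg z hz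
    rw [hD.fderiv, ← hd]
    have h3 : D τ = τ.re * D 1 + τ.im * D Complex.I := by
      have : τ = τ.re • (1 : ℂ) + τ.im • Complex.I := by simp
      conv_lhs => rw [this]
      rw [map_add, map_smul, map_smul]
      simp
    rw [h3]
    field_simp
    ring
  rw [integral_congr_ae hae, integral_add (h1.const_mul _) (h2.const_mul _),
    integral_const_mul, integral_const_mul, hf.integral_fderiv_one hτ, hf.integral_fderiv_tau hτ]
  simp

/-- The regularized integral by residues: if `∂P / ∂z̄ = Y f`, where `P` and `f` have at most simple
poles, then `⨍ f vol` is the sum of the residues of `P`. The residues of `P` are cancelled by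
multiples of translates of `ê_1`, whose antiholomorphic derivative is the constant `Y`. -/
theorem IsSimplePolar.hasRegIntegral {P : ℂ → ℂ} {t : ℂ → ℂ} (hτ : 0 < τ.im)
    (hS : ∀ p ∈ S, ∀ q ∈ S, p - q ∈ lattice τ → p = q)
    (hf : IsSimplePolar τ S f t) (hP : IsSimplePolar τ S P r)
    (hd : ∀ z ∉ poleSet τ S, HasDbarAt P (Yconst τ * f z) z) :
    HasRegIntegral τ f (∑ p ∈ S, r p) := by
  classical
  set R : ℂ := ∑ p ∈ S, r p with hR
  have hτ0 : (τ.im : ℂ) ≠ 0 := by exact_mod_cast hτ.ne'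
  have hY : Yconst τ ≠ 0 := by simp [Yconst, Real.pi_ne_zero, hτ.ne']
  have hfint := hf.integrableOn_fundDomain hτ
  have hZ : ∀ p ∈ S, IsSimplePolar τ S (fun z => ehat τ 1 (z - p))
      (fun q => if q = p then 1 else 0) := fun p hp =>
    { periodic := fun z _ l hl => by rw [add_sub_right_comm, ehat_add_of_mem hτ 1 _ hl]
      smooth := fun z hz => contDiffAt_ehat_sub hτ 1 fun h => hz ⟨p, hp, h⟩
      pole := fun q hq => by
        split_ifs with hqp
        · subst hqp
          simpa [kdelta] using hasSimplePole_ehat_sub hτ 1 q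
        · exact hasSimplePole_of_contDiffAt
            (contDiffAt_ehat_sub hτ 1 fun h => hqp (hS q hq p hp h)) }
  have hG0 := hP.add (IsSimplePolar.sum fun p hp => (hZ p hp).const_mul (-r p))
  have hG : IsSimplePolar τ S (fun z => P z + ∑ p ∈ S, -r p * ehat τ 1 (z - p)) fun _ => 0 :=
    ⟨hG0.periodic, hG0.smooth, fun q hq => by
      have := hG0.pole q hq
      simpa [hq] using this⟩
  have hGd : ∀ z ∉ poleSet τ S, HasDbarAt (fun z => P z + ∑ p ∈ S, -r p * ehat τ 1 (z - p))
      (Yconst τ * (f z - R)) z := fun z hz => by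
    have h1 : ∀ p ∈ S, HasDbarAt (fun z => -r p * ehat τ 1 (z - p)) (-r p * Yconst τ) z := by
      intro p hp
      have h2 := hasDbarAt_ehat_succ hτ 0 (z := z - p) fun h => hz ⟨p, hp, h⟩
      rw [ehat_zero, mul_one, zero_add] at h2
      exact h2.comp_sub_const.const_mul _
    convert (hd z hz).add (HasDbarAt.sum h1) using 1
    rw [← Finset.sum_mul, Finset.sum_neg_distrib, ← hR]
    ring
  have hzero := hG.integral_dbar_eq_zero hτ hGd
  rw [integral_const_mul, integral_sub hfint (integrableOn_fundDomain_const R),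
    integral_fundDomain_const hτ] at hzero
  have hval := (mul_eq_zero.mp hzero).resolve_left hY
  refine ⟨S, f, fun _ => 0, hf.memPolar, hf.memLog, ?_, ?_, hfint, ?_⟩
  · refine ⟨fun _ _ _ _ => rfl, contDiffOn_const, fun p _ => ⟨0, fun _ => 0, contDiffAt_const, ?_⟩⟩
    simp
  · intro z _
    simp [dz]
  · rw [sub_eq_zero.mp hval, inv_mul_cancel_left₀ hτ0]

end Stokes

/-! ### Residues and integrals in one variable -/

section OneVariable

variable {τ : ℂ}

lemma eq_of_mem_singleton_of_sub_mem (p : ℂ) :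
    ∀ x ∈ ({p} : Finset ℂ), ∀ y ∈ ({p} : Finset ℂ), x - y ∈ lattice τ → x = y := by
  simp

lemma eq_of_mem_pair_of_sub_mem {p q : ℂ} (hpq : q - p ∉ lattice τ) :
    ∀ x ∈ ({p, q} : Finset ℂ), ∀ y ∈ ({p, q} : Finset ℂ), x - y ∈ lattice τ → x = y := by
  have hqp : p - q ∉ lattice τ := fun h => hpq (by simpa using neg_mem_lattice h)
  simp [hpq, hqp]

lemma hasRes_const (a : ℂ) : HasRes τ (fun _ => a) 0 := by
  have h : IsSimplePolar τ ∅ (fun _ => a) fun _ => 0 :=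
    ⟨fun _ _ _ _ => rfl, fun _ _ => contDiffAt_const, by simp⟩
  simpa using h.hasRes (by simp)

lemma hasRes_ehat (hτ : 0 < τ.im) (κ : ℂ) (m : ℕ) (p : ℂ) :
    HasRes τ (fun z => κ * ehat τ m (z - p)) (κ * kdelta m 1) := by
  simpa using ((isSimplePolar_ehat_sub hτ m p).const_mul κ).hasRes
    (eq_of_mem_singleton_of_sub_mem p)

lemma hasRegIntegral_ehat (hτ : 0 < τ.im) (κ : ℂ) (m : ℕ) (p : ℂ) :
    HasRegIntegral τ (fun z => κ * ehat τ m (z - p)) (κ * kdelta m 0) := by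
  have h := IsSimplePolar.hasRegIntegral hτ (eq_of_mem_singleton_of_sub_mem p)
    ((isSimplePolar_ehat_sub hτ m p).const_mul κ)
    ((isSimplePolar_ehat_sub hτ (m + 1) p).const_mul κ) fun z hz => by
      have h1 := hasDbarAt_ehat_succ hτ m (z := z - p) fun h => hz ⟨p, by simp, h⟩
      convert h1.comp_sub_const.const_mul κ using 1
      ring
  simpa [kdelta] using h

lemma hasRegIntegral_const (hτ : 0 < τ.im) (a : ℂ) : HasRegIntegral τ (fun _ => a) a := by
  simpa [ehat_zero, kdelta] using hasRegIntegral_ehat hτ a 0 0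

lemma hasRes_ehat_mul_ehat (hτ : 0 < τ.im) (κ : ℂ) (k l : ℕ) {p q : ℂ}
    (hpq : q - p ∉ lattice τ) :
    HasRes τ (fun z => κ * (ehat τ k (z - p) * ehat τ l (q - z)))
      (κ * (kdelta k 1 * ehat τ l (q - p) - ehat τ k (q - p) * kdelta l 1)) := by
  have hne : p ≠ q := by
    rintro rfl
    exact hpq (by simpa using zero_mem_lattice)
  have h := ((isSimplePolar_ehat_mul_ehat hτ k l hpq).const_mul κ).hasRes
    (eq_of_mem_pair_of_sub_mem hpq)
  rw [Finset.sum_pair hne, if_pos rfl, if_neg hne.symm] at h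
  convert h using 1
  ring

/-- An antiholomorphic primitive of `Y ê_k(z - p) ê_l(q - z)`, obtained by integrating by parts
`l` times. -/
def pairPrimitive (τ : ℂ) (k l : ℕ) (p q z : ℂ) : ℂ :=
  ∑ i ∈ Finset.range (l + 1), ehat τ (k + 1 + i) (z - p) * ehat τ (l - i) (q - z)

lemma hasDbarAt_pairPrimitive (hτ : 0 < τ.im) (k l : ℕ) {p q z : ℂ} (hp : z - p ∉ lattice τ)
    (hq : q - z ∉ lattice τ) :
    HasDbarAt (pairPrimitive τ k l p q)
      (Yconst τ * (ehat τ k (z - p) * ehat τ l (q - z))) z := by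
  have hu : ∀ j, HasDbarAt (fun z => ehat τ (j + 1) (z - p)) (Yconst τ * ehat τ j (z - p)) z :=
    fun j => (hasDbarAt_ehat_succ hτ j hp).comp_sub_const
  have hv : ∀ j, HasDbarAt (fun z => ehat τ (j + 1) (q - z)) (-(Yconst τ * ehat τ j (q - z))) z :=
    fun j => (hasDbarAt_ehat_succ hτ j hq).comp_const_sub
  have hv0 : HasDbarAt (fun z => ehat τ 0 (q - z)) 0 z := by
    simpa only [ehat_zero] using hasDbarAt_const 1 z
  let T : ℕ → ℂ := fun i => Yconst τ * (ehat τ (k + i) (z - p) * ehat τ (l - i) (q - z))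
  have hterm : ∀ i ∈ Finset.range l, HasDbarAt
      (fun z => ehat τ (k + 1 + i) (z - p) * ehat τ (l - i) (q - z)) (T i - T (i + 1)) z := by
    intro i hi
    obtain ⟨j, hj⟩ : ∃ j, l = i + j + 1 := Nat.exists_eq_add_of_lt (Finset.mem_range.mp hi)
    have e1 : k + 1 + i = k + i + 1 := by omega
    have e2 : l - i = j + 1 := by omega
    have e3 : l - (i + 1) = j := by omega
    have h := (hu (k + i)).mul (hv j)
    rw [e1, e2]
    convert h using 1
    simp only [T, e2, e3, ← add_assoc]
    ring
  have hlast : HasDbarAt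
      (fun z => ehat τ (k + 1 + l) (z - p) * ehat τ (l - l) (q - z)) (T l) z := by
    have h := (hu (k + l)).mul hv0
    rw [show k + 1 + l = k + l + 1 by omega, Nat.sub_self]
    convert h using 1
    simp only [T, Nat.sub_self]
    ring
  have h := (HasDbarAt.sum hterm).add hlast
  rw [Finset.sum_range_sub', sub_add_cancel] at h
  unfold pairPrimitive
  simp only [Finset.sum_range_succ]
  simpa [T] using h

/-- The two residues of the primitive `pairPrimitive` add up to `ê_{k+l}(q - p)` if `k = l = 0`, to
`-ê_{k+l}(q - p)` if `k, l ≥ 1`, and to zero otherwise. -/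
lemma hasRegIntegral_ehat_mul_ehat (hτ : 0 < τ.im) (κ : ℂ) (k l : ℕ) {p q : ℂ}
    (hpq : q - p ∉ lattice τ) :
    HasRegIntegral τ (fun z => κ * (ehat τ k (z - p) * ehat τ l (q - z)))
      (κ * (ehat τ (k + l) (q - p) *
        (kdelta k 0 * kdelta l 0 - (kdelta k 0 - 1) * (kdelta l 0 - 1)))) := by
  have hne : p ≠ q := by
    rintro rfl
    exact hpq (by simpa using zero_mem_lattice)
  have hP := (IsSimplePolar.sum (s := Finset.range (l + 1)) fun i _ =>
    isSimplePolar_ehat_mul_ehat hτ (k + 1 + i) (l - i) hpq).const_mul κ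
  have h := IsSimplePolar.hasRegIntegral hτ (eq_of_mem_pair_of_sub_mem hpq)
    ((isSimplePolar_ehat_mul_ehat hτ k l hpq).const_mul κ) hP fun z hz => by
      have h1 := hasDbarAt_pairPrimitive hτ k l (z := z) (fun h => hz ⟨p, by simp, h⟩)
        (fun h => hz ⟨q, by simp, by simpa using neg_mem_lattice h⟩)
      convert h1.const_mul κ using 1
      · rfl
      · ring
  rw [Finset.sum_pair hne] at h
  simp only [if_true, if_neg hne.symm] at h
  convert h using 1
  rw [← mul_add]
  congr 1
  have h0 : ∑ i ∈ Finset.range (l + 1), kdelta (k + 1 + i) 1 * ehat τ (l - i) (q - p) =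
      kdelta k 0 * ehat τ l (q - p) := by
    rw [Finset.sum_eq_single 0]
    · simp [kdelta]
    · intro i _ hi
      simp [kdelta, show k + 1 + i ≠ 1 by omega]
    · simp
  have h1 : ∑ i ∈ Finset.range (l + 1), -(ehat τ (k + 1 + i) (q - p) * kdelta (l - i) 1) =
      (kdelta l 0 - 1) * ehat τ (k + l) (q - p) := by
    cases l with
    | zero => simp [kdelta]
    | succ l =>
      rw [Finset.sum_eq_single l]
      · simp [kdelta, show k + 1 + l = k + (l + 1) by omega]
      · intro i _ hi
        simp [kdelta, show l + 1 - i ≠ 1 by omega]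
      · simp
  rw [h0, h1]
  by_cases hk : k = 0
  · subst hk
    simp only [kdelta, if_true, zero_add]
    ring
  · simp only [kdelta, if_neg hk]
    ring

end OneVariable

/-! ### Chains -/

section Chain

variable {τ : ℂ}

/-- The first variable of a chain occurs in the first factor only. -/
lemma exists_xiChain_cons (τ : ℂ) {n : ℕ} (c : Fin (n + 1) → Fin (n + 1) → ℂ) (z₀ : ℂ)
    (m : Fin (n + 1) → ℕ) : ∃ p : (Fin n → ℂ) → ℂ, ∀ z w,
      xiChain τ c z₀ m (Fin.cons z w : Fin (n + 1) → ℂ) =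
        xiChain τ (fun i j => c i.succ j.succ) z₀ (fun i => m i.succ) w *
          ehat τ (m 0) (z - p w) := by
  refine ⟨fun w => if h : 0 < n then w ⟨0, h⟩ - c 0 (Fin.succ ⟨0, h⟩) else z₀, fun z w => ?_⟩
  rw [xiChain, Fin.prod_univ_succ, mul_comm]
  congr 1
  · refine Finset.prod_congr rfl fun k _ => ?_
    congr 1
    by_cases h : (k : ℕ) + 1 < n
    · have h' : ((k.succ : Fin (n + 1)) : ℕ) + 1 < n + 1 := by simpa using h
      rw [dif_pos h, dif_pos h']
      have : (⟨(k.succ : ℕ) + 1, h'⟩ : Fin (n + 1)) = Fin.succ ⟨(k : ℕ) + 1, h⟩ := rfl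
      simp only [s, this, Fin.cons_succ]
    · have h' : ¬ ((k.succ : Fin (n + 1)) : ℕ) + 1 < n + 1 := by simpa using h
      rw [dif_neg h, dif_neg h', Fin.cons_succ]
  · congr 1
    beta_reduce
    by_cases h : 0 < n
    · have h' : ((0 : Fin (n + 1)) : ℕ) + 1 < n + 1 := by simpa using h
      rw [dif_pos h, dif_pos h']
      have : (⟨((0 : Fin (n + 1)) : ℕ) + 1, h'⟩ : Fin (n + 1)) = Fin.succ ⟨0, h⟩ := rfl
      simp only [s, this, Fin.cons_succ, Fin.cons_zero]
      ring
    · have h' : ¬ ((0 : Fin (n + 1)) : ℕ) + 1 < n + 1 := by simpa using h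
      rw [dif_neg h, dif_neg h', Fin.cons_zero]

/-- An operation that is known on translates of `ê_m` is evaluated on chains one variable at a
time. -/
lemma hasIterated_xiChain {R : (ℂ → ℂ) → ℂ → Prop} {a : ℕ → ℂ}
    (hR : ∀ κ m p, R (fun z => κ * ehat τ m (z - p)) (κ * a m)) (z₀ : ℂ) :
    ∀ (n : ℕ) (c : Fin n → Fin n → ℂ) (m : Fin n → ℕ) (κ : ℂ),
      HasIterated τ R n (fun z => κ * xiChain τ c z₀ m z) (κ * ∏ k, a (m k)) := by
  intro n
  induction n with
  | zero =>
    intro c m κ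
    simp [HasIterated, xiChain]
  | succ n ih =>
    intro c m κ
    obtain ⟨p, hp⟩ := exists_xiChain_cons τ c z₀ m
    refine ⟨fun w => (κ * a (m 0)) *
      xiChain τ (fun i j => c i.succ j.succ) z₀ (fun i => m i.succ) w, ⟨∅, fun w _ => ?_⟩, ?_⟩
    · convert hR (κ * xiChain τ (fun i j => c i.succ j.succ) z₀ (fun i => m i.succ) w) (m 0) (p w)
        using 1
      · funext z
        beta_reduce
        rw [hp, mul_assoc]
      · ring
    · convert ih (fun i j => c i.succ j.succ) (fun i => m i.succ) (κ * a (m 0)) using 1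
      rw [Fin.prod_univ_succ, mul_assoc]

end Chain

/-! ### Loops -/

section Loop

variable {τ : ℂ}

/-- A loop in `n + 1` variables, with the closing factor, of shift `e` and index `μ`, singled
out. -/
def loopFun (τ : ℂ) (n : ℕ) (d : Fin n → ℂ) (e : ℂ) (m : Fin n → ℕ) (μ : ℕ)
    (w : Fin (n + 1) → ℂ) : ℂ :=
  (∏ j : Fin n, ehat τ (m j) (d j + w j.castSucc - w j.succ)) *
    ehat τ μ (e + w (Fin.last n) - w 0)

lemma xiLoop_eq_loopFun (τ : ℂ) {n : ℕ} (c : Fin (n + 1) → Fin (n + 1) → ℂ)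
    (m : Fin (n + 1) → ℕ) :
    xiLoop τ c m = loopFun τ n (fun j => c j.castSucc j.succ) (c (Fin.last n) 0)
      (fun j => m j.castSucc) (m (Fin.last n)) := by
  funext z
  simp [xiLoop, loopFun, Fin.prod_univ_castSucc, s]

lemma loopFun_cons (n : ℕ) (d : Fin (n + 1) → ℂ) (e : ℂ) (m : Fin (n + 1) → ℕ) (μ : ℕ) (z : ℂ)
    (w : Fin (n + 1) → ℂ) :
    loopFun τ (n + 1) d e m μ (Fin.cons z w : Fin (n + 2) → ℂ) =
      (∏ j : Fin n, ehat τ (m j.succ) (d j.succ + w j.castSucc - w j.succ)) *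
        (ehat τ (m 0) (z - (w 0 - d 0)) * ehat τ μ (e + w (Fin.last n) - z)) := by
  rw [loopFun, Fin.prod_univ_succ]
  simp only [Fin.castSucc_zero, Fin.cons_zero, Fin.cons_succ, ← Fin.succ_castSucc, ← Fin.succ_last]
  rw [show d 0 + z - w 0 = z - (w 0 - d 0) by ring]
  ring

/-- An operation that turns `ê_k(z - p) ê_l(q - z)` into a multiple `B k l` of the function
`ê_{N k l}(q - p)` contracts a loop to a loop with one variable less. -/
lemma hasIterated_loopFun_succ {R : (ℂ → ℂ) → ℂ → Prop} {B : ℕ → ℕ → ℂ} {N : ℕ → ℕ → ℕ}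
    (hR : ∀ κ k l p q, q - p ∉ lattice τ →
      R (fun z => κ * (ehat τ k (z - p) * ehat τ l (q - z))) (κ * (B k l * ehat τ (N k l) (q - p))))
    (n : ℕ) (d : Fin (n + 1) → ℂ) (e : ℂ) (hc : ∑ j, d j + e ∉ lattice τ) (m : Fin (n + 1) → ℕ)
    (μ : ℕ) (κ v : ℂ)
    (h : HasIterated τ R (n + 1) (fun w => (κ * B (m 0) μ) *
      loopFun τ n (fun j => d j.succ) (e + d 0) (fun j => m j.succ) (N (m 0) μ) w) v) :
    HasIterated τ R (n + 2) (fun w => κ * loopFun τ (n + 1) d e m μ w) v := by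
  refine ⟨_, ⟨{-(e + d 0)}, fun w hw => ?_⟩, h⟩
  have hpq : e + w (Fin.last n) - (w 0 - d 0) ∉ lattice τ := by
    intro hmem
    -- With a single remaining variable the difference of the poles is the constant `∑ d + e`;
    -- otherwise it avoids the lattice off a divisor.
    by_cases hn : n = 0
    · subst hn
      apply hc
      convert hmem using 1
      simp
      ring
    · refine hw ⟨-(e + d 0), by simp, Or.inr ⟨Fin.last n, 0, ?_, ?_⟩⟩
      · intro h0
        exact hn (by simpa using congrArg Fin.val h0)
      · convert hmem using 1
        ring
  convert hR (κ * ∏ j : Fin n, ehat τ (m j.succ) (d j.succ + w j.castSucc - w j.succ)) (m 0) μ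
    (w 0 - d 0) (e + w (Fin.last n)) hpq using 1
  · funext z
    beta_reduce
    rw [loopFun_cons, mul_assoc]
  · rw [loopFun, show e + d 0 + w (Fin.last n) - w 0 = e + w (Fin.last n) - (w 0 - d 0) by ring]
    ring

/-- A loop in one variable is constant. -/
lemma hasIterated_loopFun_zero {R : (ℂ → ℂ) → ℂ → Prop} (d : Fin 0 → ℂ) (e : ℂ)
    (m : Fin 0 → ℕ) (μ : ℕ) (κ v : ℂ) (hR : R (fun _ => κ * ehat τ μ e) v) :
    HasIterated τ R 1 (fun w => κ * loopFun τ 0 d e m μ w) v := by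
  refine ⟨fun _ => v, ⟨∅, fun w _ => ?_⟩, rfl⟩
  simpa [loopFun] using hR

lemma hasIterRes_loopFun (hτ : 0 < τ.im) : ∀ (n : ℕ) (d : Fin n → ℂ) (e : ℂ)
    (_ : ∑ j, d j + e ∉ lattice τ) (m : Fin n → ℕ) (μ : ℕ) (κ : ℂ),
    HasIterRes τ (n + 1) (fun w => κ * loopFun τ n d e m μ w) 0 := by
  intro n
  induction n with
  | zero =>
    intro d e _ m μ κ
    exact hasIterated_loopFun_zero d e m μ κ 0 (hasRes_const _)
  | succ n ih =>
    intro d e hc m μ κ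
    -- The two residues `δ_{k,1} ê_l` and `-δ_{l,1} ê_k` cancel if `k = l = 1`; otherwise at most
    -- one of them is present.
    refine hasIterated_loopFun_succ (R := HasRes τ)
      (B := fun k l => if k = 1 then (if l = 1 then 0 else 1) else (if l = 1 then -1 else 0))
      (N := fun k l => if k = 1 then l else k) ?_ n d e hc m μ κ 0 (ih _ _ ?_ _ _ _)
    · intro κ k l p q hpq
      convert hasRes_ehat_mul_ehat hτ κ k l hpq using 2
      by_cases hk : k = 1 <;> by_cases hl : l = 1 <;> simp [hk, hl, kdelta]
    · rwa [Fin.sum_univ_succ, add_comm (d 0), add_assoc, add_comm (d 0)] at hc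

lemma hasIterRegIntegral_loopFun (hτ : 0 < τ.im) : ∀ (n : ℕ) (d : Fin n → ℂ) (e : ℂ)
    (_ : ∑ j, d j + e ∉ lattice τ) (m : Fin n → ℕ) (μ : ℕ) (κ : ℂ),
    HasIterRegIntegral τ (n + 1) (fun w => κ * loopFun τ n d e m μ w)
      (κ * (ehat τ (∑ j, m j + μ) (∑ j, d j + e) *
        ((∏ j, kdelta (m j) 0) * kdelta μ 0 -
          (∏ j, (kdelta (m j) 0 - 1)) * (kdelta μ 0 - 1)))) := by
  intro n
  induction n with
  | zero =>
    intro d e _ m μ κ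
    refine hasIterated_loopFun_zero d e m μ κ _ ?_
    simpa using hasRegIntegral_const hτ (κ * ehat τ μ e)
  | succ n ih =>
    intro d e hc m μ κ
    have hsum : ∑ j, d j + e = ∑ j : Fin n, d j.succ + (e + d 0) := by
      rw [Fin.sum_univ_succ]
      ring
    refine hasIterated_loopFun_succ (R := HasRegIntegral τ)
      (B := fun k l => kdelta k 0 * kdelta l 0 - (kdelta k 0 - 1) * (kdelta l 0 - 1))
      (N := fun k l => k + l) ?_ n d e hc m μ κ _ ?_
    · intro κ k l p q hpq
      convert hasRegIntegral_ehat_mul_ehat hτ κ k l hpq using 2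
      ring
    · have h : HasIterated τ (HasRegIntegral τ) _ _ _ :=
        ih (fun j => d j.succ) (e + d 0) (by rwa [← hsum]) (fun j => m j.succ) (m 0 + μ)
        (κ * (kdelta (m 0) 0 * kdelta μ 0 - (kdelta (m 0) 0 - 1) * (kdelta μ 0 - 1)))
      convert h using 1
      rw [← hsum, Fin.sum_univ_succ m, Fin.prod_univ_succ, Fin.prod_univ_succ,
        show m 0 + ∑ i : Fin n, m i.succ + μ = ∑ i : Fin n, m i.succ + (m 0 + μ) by ring]
      by_cases h0 : m 0 = 0 <;> by_cases h1 : μ = 0 <;> simp [h0, h1, kdelta]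

end Loop

end EllipticIterated

end

theorem mainTheorem2 (τ : ℂ) (hτ : 0 < τ.im) (n : ℕ) (hn : 2 ≤ n)
    (c : Fin n → Fin n → ℂ)
    (hc : ∑ k : Fin n, c k (finRotate n k) ∉ EllipticIterated.lattice τ)
    (z₀ : ℂ) (m : Fin n → ℕ) :
    (EllipticIterated.HasIterRes τ n (EllipticIterated.xiChain τ c z₀ m)
        (∏ k : Fin n, EllipticIterated.kdelta (m k) 1) ∧
      EllipticIterated.HasIterRes τ n (EllipticIterated.xiLoop τ c m) 0) ∧
    (EllipticIterated.HasIterRegIntegral τ n (EllipticIterated.xiChain τ c z₀ m)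
        (∏ k : Fin n, EllipticIterated.kdelta (m k) 0) ∧
      ∀ z : Fin n → ℂ,
        EllipticIterated.HasIterRegIntegral τ n (EllipticIterated.xiLoop τ c m)
          (EllipticIterated.ehat τ (∑ k : Fin n, m k)
              (∑ k : Fin n, EllipticIterated.s c z k (finRotate n k)) *
            ((∏ k : Fin n, EllipticIterated.kdelta (m k) 0) -
                ∏ k : Fin n, (EllipticIterated.kdelta (m k) 0 - 1)))) := by
  obtain ⟨n, rfl⟩ : ∃ k, n = k + 1 := ⟨n - 1, by omega⟩
  have hsum : ∑ k : Fin (n + 1), c k (finRotate (n + 1) k) =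
      ∑ j : Fin n, c j.castSucc j.succ + c (Fin.last n) 0 := by
    simp [Fin.sum_univ_castSucc]
  rw [hsum] at hc
  refine ⟨⟨?_, ?_⟩, ?_, fun z => ?_⟩
  · simpa using! EllipticIterated.hasIterated_xiChain
      (EllipticIterated.hasRes_ehat hτ) z₀ (n + 1) c m 1
  · rw [EllipticIterated.xiLoop_eq_loopFun]
    simpa using! EllipticIterated.hasIterRes_loopFun hτ n _ _ hc (fun j => m j.castSucc)
      (m (Fin.last n)) 1
  · simpa using! EllipticIterated.hasIterated_xiChain
      (EllipticIterated.hasRegIntegral_ehat hτ) z₀ (n + 1) c m 1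
  · have hs : ∑ k : Fin (n + 1), EllipticIterated.s c z k (finRotate (n + 1) k) =
        ∑ j : Fin n, c j.castSucc j.succ + c (Fin.last n) 0 := by
      have hrot : ∑ k : Fin (n + 1), z (finRotate (n + 1) k) = ∑ k : Fin (n + 1), z k :=
        Equiv.sum_comp (finRotate (n + 1)) z
      simp only [EllipticIterated.s, Finset.sum_sub_distrib, Finset.sum_add_distrib, hrot, hsum]
      ring
    rw [hs, EllipticIterated.xiLoop_eq_loopFun]
    simpa [Fin.sum_univ_castSucc, Fin.prod_univ_castSucc] using!
      EllipticIterated.hasIterRegIntegral_loopFun hτ n _ _ hc (fun j => m j.castSucc)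
        (m (Fin.last n)) 1
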